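/- Let $b:\mathbb{R}\to\mathbb{R}$ be of class $C^3$, monotonically increasing, bounded, odd and Lipschitz; let $w:\mathbb{R}\to[0,\infty)$ be even, bounded and of class $C^2$; and let $\sigma\ge 0$ be constant. For a function $g=g(\theta,r)$ on $\mathbb{R}^2$ put $$a[g](\theta,r)=\int_{\mathbb{R}^2} w(r-r')\big(b(\theta-\theta')+\sigma^2 b''(\theta-\theta')-b(r-r')\big)\,g(\theta',r')\,dr'\,d\theta'.$$ Let $f^0\in C^1(\mathbb{R}^2)$ have compact support (so that $f^0$ and $\partial_r f^0$ are bounded). Then for every $T\in(0,\infty)$ there exists a unique classical solution $f=f(t,\theta,r)\in C^1([0,T)\times\mathbb{R}^2)$ of $$\partial_t f+\partial_r\big(a[f(t,\cdot)]\,f\big)=0\ \text{ in }[0,T)\times\mathbb{R}^2,\qquad f(0,\theta,r)=f^0(\theta,r)\ \text{ in }\mathbb{R}^2 .$$ Here $C^1([0,T)\times\mathbb{R}^2)$ means continuously differentiable up to $t=0$, with the one-sided time derivative there. A classical solution is an $f\in C^1([0,T)\times\mathbb{R}^2)$ for which the integral defining $a[f(t,\cdot)](\theta,r)$ converges absolutely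 for all $(t,\theta,r)$, the function $a[f(t,\cdot)](\theta,r)$ is bounded on $[0,\tau]\times[-R,R]\times\mathbb{R}$ for all $\tau<T$ and $R>0$, the function $r\mapsto a[f(t,\cdot)](\theta,r)f(t,\theta,r)$ is differentiable, and the equation and the initial condition hold at every point. Uniqueness is meant within this class. -/

import Mathlib

open MeasureTheory Set

/-- Standing assumptions on the function `b` giving the expected outcome of a game: of class `C^3`,
monotonically increasing, bounded, odd and Lipschitz. -/
structure IsOutcomeFunction (b : ℝ → ℝ) : Prop where
  contDiff : ContDiff ℝ 3 b
  monotone : Monotone b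
  bounded : ∃ C : ℝ, ∀ z, |b z| ≤ C
  odd : ∀ z, b (-z) = -b z
  lipschitz : ∃ L, LipschitzWith L b

/-- Standing assumptions on the interaction rate `w`: nonnegative, even, of class `C^2`
and bounded. -/
structure IsInteractionRate (w : ℝ → ℝ) : Prop where
  nonneg : ∀ z, 0 ≤ w z
  even : ∀ z, w (-z) = w z
  contDiff : ContDiff ℝ 2 w
  bounded : ∃ C : ℝ, ∀ z, w z ≤ C

/-- The integrand, at `p = (θ', r')`, of the velocity generated at `(θ, r)` by the
density `g = g(θ', r')`. -/
noncomputable def velocityIntegrand (w b : ℝ → ℝ) (σ : ℝ) (g : ℝ → ℝ → ℝ) (θ r : ℝ)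
    (p : ℝ × ℝ) : ℝ :=
  w (r - p.2) * (b (θ - p.1) + σ ^ 2 * iteratedDeriv 2 b (θ - p.1) - b (r - p.2)) * g p.1 p.2

/-- The velocity
`a[g](θ, r) = ∫ w(r - r') (b(θ - θ') + σ² b''(θ - θ') - b(r - r')) g(θ', r') dr' dθ'`. -/
noncomputable def velocity (w b : ℝ → ℝ) (σ : ℝ) (g : ℝ → ℝ → ℝ) (θ r : ℝ) : ℝ :=
  ∫ p : ℝ × ℝ, velocityIntegrand w b σ g θ r p

/-- `f = f(t, θ, r)` is a classical solution on `[0, T) × ℝ²` of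
`∂ₜ f + ∂ᵣ (a[f] f) = 0`, `f(0, ·) = f₀`.

Besides `f ∈ C^1([0, T) × ℝ²)` (with one-sided time derivative at `t = 0`), the equation and the
initial condition, this asks that the velocity `a[f]` makes sense as a convergent integral
at every point and is bounded in `r`, locally uniformly in `(t, θ)`.
For instance the last two hold if `f(t, ·)` is supported in a compact set that is locally
uniform in `t`, or if `b''` is bounded and the mass `∫ |f(t, ·)|` is locally bounded in `t`. -/
structure IsClassicalSolution (w b : ℝ → ℝ) (σ : ℝ) (f₀ : ℝ → ℝ → ℝ) (T : ℝ)
    (f : ℝ → ℝ → ℝ → ℝ) : Prop where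
  contDiffOn : ContDiffOn ℝ 1 (fun p : ℝ × ℝ × ℝ => f p.1 p.2.1 p.2.2) (Ico 0 T ×ˢ univ)
  integrable : ∀ t ∈ Ico 0 T, ∀ θ r : ℝ, Integrable (velocityIntegrand w b σ (f t) θ r)
  velocity_bounded : ∀ τ < T, ∀ R : ℝ, ∃ M : ℝ, ∀ t ∈ Icc 0 τ, ∀ θ : ℝ, |θ| ≤ R → ∀ r : ℝ,
    |velocity w b σ (f t) θ r| ≤ M
  flux_differentiable : ∀ t ∈ Ico 0 T, ∀ θ : ℝ,
    Differentiable ℝ (fun r => velocity w b σ (f t) θ r * f t θ r)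
  equation : ∀ t ∈ Ico 0 T, ∀ θ r : ℝ,
    derivWithin (fun s => f s θ r) (Ico 0 T) t
      + deriv (fun r' => velocity w b σ (f t) θ r' * f t θ r') r = 0
  initial : ∀ θ r : ℝ, f 0 θ r = f₀ θ r

/-! ### Ordinary differential equations with globally Lipschitz right-hand side in Banach spaces. -/

section ODE

open scoped NNReal Topology

variable {E : Type*} [NormedAddCommGroup E] [NormedSpace ℝ E]

/-! Existence is Lagrangian. Nothing moves in `θ`, so a solution is the push-forward of `f₀` under
maps `(θ, r) ↦ (θ, r + u t (θ, r))`. In terms of the displacement `u`, the nonlocal equation becomes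
an autonomous ODE in the Banach space of bounded continuous functions, with Lipschitz right-hand
side as soon as the kernel is bounded and Lipschitz (`exists_displacement`). Once `u` is known, so
is the velocity, and the equation is a linear transport equation solved by characteristics. These
carry an extra coordinate for the integral of the divergence, which is the logarithm of the
Jacobian; the change of variables along them identifies the velocity generated by the solution with
the given one (`exists_solution_of_hasCompactSupport_kernel`).

The true kernel need not be bounded or Lipschitz, since `b''` is only `C^1`. But `θ` stays in the
support of `f₀`, where the kernel has a bound `M`, so particles move with speed at most `M * ∫
|f₀|`, whatever the cutoff. A cutoff far enough out is therefore invisible up to time `T`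
(`exists_isClassicalSolution`).

For uniqueness, a classical solution has bounded velocity on bounded ranges of `θ`, and its flux is
at most `M |f|`. Finite speed of propagation (`eq_zero_of_abs_flux_le`) then confines the support to
a compact set on every `[0, τ]`. There the difference of two solutions satisfies an `L²` energy
estimate `E' ≤ C E` (`integral_sub_mul_sub_le`), and `E 0 = 0` forces equality (`eq_on_Icc`). -/

theorem gronwallBound_eq_add (δ K ε x : ℝ) :
    gronwallBound δ K ε x = δ * Real.exp (K * x) + ε * gronwallBound 0 K 1 x := by
  unfold gronwallBound
  split_ifs with h
  · simp [h]
  · ring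

theorem gronwallBound_zero_one_nonneg {K x : ℝ} (hK : 0 ≤ K) (hx : 0 ≤ x) :
    0 ≤ gronwallBound 0 K 1 x := by
  have := gronwallBound_mono le_rfl zero_le_one hK hx
  simpa [gronwallBound_x0] using this

theorem HasDerivAt.comp_neg_arg {f : ℝ → E} {f' : E} {s : ℝ} (hf : HasDerivAt f f' (-s)) :
    HasDerivAt (fun s => f (-s)) (-f') s := by
  simpa using! HasDerivAt.scomp s hf (hasDerivAt_neg s)

/-- Grönwall's inequality on both sides of the initial time. -/
theorem dist_le_gronwallBound_abs {v : ℝ → E → E} {K : ℝ≥0} {T ε δ : ℝ} {f g f' : ℝ → E}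
    (hv : ∀ t, LipschitzWith K (v t))
    (hf : ∀ t, |t| < T → HasDerivAt f (f' t) t)
    (hf' : ∀ t, |t| < T → dist (f' t) (v t (f t)) ≤ ε)
    (hg : ∀ t, |t| < T → HasDerivAt g (v t (g t)) t)
    (h0 : dist (f 0) (g 0) ≤ δ) {t : ℝ} (ht : |t| < T) :
    dist (f t) (g t) ≤ gronwallBound δ K ε |t| := by
  have key : ∀ {v : ℝ → E → E} {f g f' : ℝ → E} {t : ℝ}, 0 ≤ t →
      (∀ t, LipschitzWith K (v t)) → (∀ s ∈ Icc 0 t, HasDerivAt f (f' s) s) →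
      (∀ s ∈ Icc 0 t, dist (f' s) (v s (f s)) ≤ ε) →
      (∀ s ∈ Icc 0 t, HasDerivAt g (v s (g s)) s) → dist (f 0) (g 0) ≤ δ →
      dist (f t) (g t) ≤ gronwallBound δ K ε t := by
    intro v f g f' t ht hv hf hf' hg h0
    have := dist_le_of_approx_trajectories_ODE (E := E) (v := v) (K := K) (f := f) (g := g)
      (f' := f') (g' := fun s => v s (g s)) (a := 0) (b := t) (εf := ε) (εg := 0) (δ := δ) hv
      (fun s hs => (hf s hs).continuousAt.continuousWithinAt)
      (fun s hs => (hf s (Ico_subset_Icc_self hs)).hasDerivWithinAt)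
      (fun s hs => hf' s (Ico_subset_Icc_self hs))
      (fun s hs => (hg s hs).continuousAt.continuousWithinAt)
      (fun s hs => (hg s (Ico_subset_Icc_self hs)).hasDerivWithinAt)
      (fun s hs => by simp) h0 t ⟨ht, le_rfl⟩
    simpa using this
  rcases le_total 0 t with h | h
  · rw [abs_of_nonneg h] at ht ⊢
    have hs : ∀ s ∈ Icc 0 t, |s| < T := fun s hs => by
      rw [abs_of_nonneg hs.1]; exact hs.2.trans_lt ht
    exact key h hv (fun s h => hf s (hs s h)) (fun s h => hf' s (hs s h))
      (fun s h => hg s (hs s h)) h0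
  · rw [abs_of_nonpos h] at ht ⊢
    have hs : ∀ s ∈ Icc 0 (-t), |-s| < T := fun s hs => by
      rw [abs_neg, abs_of_nonneg hs.1]; exact hs.2.trans_lt ht
    have := key (v := fun s x => -v (-s) x) (f := fun s => f (-s)) (g := fun s => g (-s))
      (f' := fun s => -f' (-s)) (t := -t) (by linarith)
      (fun s => (hv (-s)).neg)
      (fun s h => (hf _ (hs s h)).comp_neg_arg)
      (fun s h => by simpa [dist_neg_neg] using hf' _ (hs s h))
      (fun s h => (hg _ (hs s h)).comp_neg_arg)
      (by simpa using h0)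
    simpa using this

theorem eq_of_hasDerivAt_of_lipschitz {v : ℝ → E → E} {K : ℝ≥0} {T : ℝ} {f g : ℝ → E}
    (hv : ∀ t, LipschitzWith K (v t))
    (hf : ∀ t, |t| < T → HasDerivAt f (v t (f t)) t)
    (hg : ∀ t, |t| < T → HasDerivAt g (v t (g t)) t)
    (h0 : f 0 = g 0) {t : ℝ} (ht : |t| < T) : f t = g t := by
  have := dist_le_gronwallBound_abs hv hf (ε := 0) (fun t _ => by simp) hg (δ := 0) (by simp [h0]) ht
  rw [gronwallBound_ε0_δ0] at this
  exact dist_le_zero.1 this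

/-- The radial retraction onto the ball of radius `R`. -/
noncomputable def radialRetraction (R : ℝ) (x : E) : E := (R / max R ‖x‖) • x

theorem radialRetraction_of_norm_le {R : ℝ} (hR : 0 < R) {x : E} (hx : ‖x‖ ≤ R) :
    radialRetraction R x = x := by
  simp [radialRetraction, max_eq_left hx, hR.ne']

theorem norm_radialRetraction_le {R : ℝ} (hR : 0 < R) (x : E) : ‖radialRetraction R x‖ ≤ R := by
  have hm : 0 < max R ‖x‖ := lt_max_of_lt_left hR
  rw [radialRetraction, norm_smul, Real.norm_of_nonneg (by positivity), div_mul_eq_mul_div,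
    div_le_iff₀ hm]
  gcongr
  exact le_max_right _ _

theorem norm_radialRetraction_le_norm {R : ℝ} (hR : 0 < R) (x : E) :
    ‖radialRetraction R x‖ ≤ ‖x‖ := by
  have hm : 0 < max R ‖x‖ := lt_max_of_lt_left hR
  rw [radialRetraction, norm_smul, Real.norm_of_nonneg (by positivity)]
  exact mul_le_of_le_one_left (norm_nonneg _) ((div_le_one hm).2 (le_max_left _ _))

/-- The constant 2 has one unit from moving the point with the scaling factor fixed and one from
changing the factor, because the rescaled `y` has norm at most `R`. No inner product is used. -/
theorem lipschitzWith_radialRetraction {R : ℝ} (hR : 0 < R) :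
    LipschitzWith 2 (radialRetraction R : E → E) := by
  refine LipschitzWith.of_dist_le_mul fun x y => ?_
  rw [dist_eq_norm, dist_eq_norm]
  set p := max R ‖x‖ with hp
  set q := max R ‖y‖ with hq
  have hp0 : 0 < p := lt_max_of_lt_left hR
  have hq0 : 0 < q := lt_max_of_lt_left hR
  have hpq : |q - p| ≤ ‖x - y‖ := by
    have h1 : |q - p| ≤ |‖y‖ - ‖x‖| := by
      simpa using abs_max_sub_max_le_max R ‖y‖ R ‖x‖
    exact h1.trans (by rw [abs_sub_comm]; exact abs_norm_sub_norm_le x y)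
  have e : radialRetraction R x - radialRetraction R y
      = (R / p) • (x - y) + ((q - p) / p * (R / q)) • y := by
    have : (q - p) / p * (R / q) = R / p - R / q := by field_simp
    rw [radialRetraction, radialRetraction, this, smul_sub, sub_smul]
    abel
  have hyq : (R / q) * ‖y‖ ≤ R := by
    rw [div_mul_eq_mul_div, div_le_iff₀ hq0]; gcongr; exact le_max_right _ _
  have hRp : R / p ≤ 1 := (div_le_one hp0).2 (le_max_left _ _)
  rw [e]
  calc _ ≤ ‖(R / p) • (x - y)‖ + ‖((q - p) / p * (R / q)) • y‖ := norm_add_le _ _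
    _ = (R / p) * ‖x - y‖ + |q - p| / p * ((R / q) * ‖y‖) := by
      rw [norm_smul, norm_smul, Real.norm_of_nonneg (by positivity), norm_mul, norm_div,
        Real.norm_of_nonneg hp0.le, Real.norm_of_nonneg (by positivity : 0 ≤ R / q),
        Real.norm_eq_abs]
      ring
    _ ≤ 1 * ‖x - y‖ + ‖x - y‖ / p * R := by gcongr
    _ = ‖x - y‖ + (R / p) * ‖x - y‖ := by ring
    _ ≤ ‖x - y‖ + 1 * ‖x - y‖ := by gcongr
    _ = _ := by norm_num; ring

variable [CompleteSpace E]

theorem exists_hasDerivAt_of_lipschitz_of_bounded {v : ℝ → E → E} {K L : ℝ≥0}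
    (hv : ∀ t, LipschitzWith K (v t)) (hc : ∀ x, Continuous fun t => v t x) {T : ℝ} (hT : 0 < T)
    (hL : ∀ t ∈ Icc (-T) T, ∀ x, ‖v t x‖ ≤ L) (x₀ : E) :
    ∃ α : ℝ → E, α 0 = x₀ ∧ ∀ t, |t| < T → HasDerivAt α (v t (α t)) t := by
  -- A curve of speed at most `L` stays within `L * T` of `x₀`; a ball of that radius spares any
  -- shrinking of the time interval.
  have hpl : IsPicardLindelof v (tmin := -T) (tmax := T) ⟨0, by constructor <;> linarith⟩ x₀
      (L * T.toNNReal) 0 L K :=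
    { lipschitzOnWith := fun t _ => (hv t).lipschitzOnWith
      continuousOn := fun x _ => (hc x).continuousOn
      norm_le := fun t ht x _ => hL t ht x
      mul_max_le := by simp [hT.le] }
  obtain ⟨α, h0, h⟩ := hpl.exists_eq_forall_mem_Icc_hasDerivWithinAt₀
  refine ⟨α, h0, fun t ht => ?_⟩
  rw [abs_lt] at ht
  exact (h t ⟨ht.1.le, ht.2.le⟩).hasDerivAt (Icc_mem_nhds ht.1 ht.2)

/-- The field is made bounded by composing it with the retraction onto a ball about `x₀`. The linear
growth bound `C + K ‖x - x₀‖` survives the truncation, so Grönwall keeps the solution in the ball,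
where nothing was changed. -/
theorem exists_hasDerivAt_of_lipschitz_of_lt {v : ℝ → E → E} {K : ℝ≥0}
    (hv : ∀ t, LipschitzWith K (v t)) (hc : ∀ x, Continuous fun t => v t x) {T : ℝ} (hT : 0 < T)
    (x₀ : E) :
    ∃ α : ℝ → E, α 0 = x₀ ∧ ∀ t, |t| < T → HasDerivAt α (v t (α t)) t := by
  obtain ⟨C, hC⟩ := (isCompact_Icc (a := -T) (b := T)).exists_bound_of_continuousOn
    (hc x₀).continuousOn
  have hC0 : 0 ≤ C := (norm_nonneg _).trans (hC 0 ⟨by linarith, hT.le⟩)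
  set R : ℝ := gronwallBound 0 K C T + 1
  have hR : 0 < R := by
    have := gronwallBound_zero_one_nonneg K.2 hT.le
    have h2 : gronwallBound 0 K C T = C * gronwallBound 0 K 1 T := by
      rw [gronwallBound_eq_add]; ring
    have : 0 ≤ gronwallBound 0 K C T := by rw [h2]; positivity
    positivity
  set u : ℝ → E → E := fun t x => v t (x₀ + radialRetraction R (x - x₀))
  have hu : ∀ t, LipschitzWith (K * 2) (u t) := fun t => by
    have h1 : LipschitzWith 2 fun x : E => x₀ + radialRetraction R (x - x₀) :=
      LipschitzWith.of_dist_le_mul fun x y => by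
        simpa using (lipschitzWith_radialRetraction hR).dist_le_mul (x - x₀) (y - x₀)
    exact (hv t).comp h1
  have hb : ∀ t ∈ Icc (-T) T, ∀ z, ‖v t (x₀ + z)‖ ≤ C + K * ‖z‖ := fun t ht z => by
    have h1 := (hv t).dist_le_mul (x₀ + z) x₀
    rw [dist_eq_norm, dist_eq_norm, add_sub_cancel_left] at h1
    calc _ = ‖v t x₀ + (v t (x₀ + z) - v t x₀)‖ := by congr 1; abel
      _ ≤ _ := (norm_add_le _ _).trans (add_le_add (hC t ht) h1)
  obtain ⟨α, h0, h⟩ := exists_hasDerivAt_of_lipschitz_of_bounded hu (fun x => hc _) hT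
    (L := ⟨C + K * R, by positivity⟩) (fun t ht x => (hb t ht _).trans (by
      show C + K * _ ≤ C + K * R
      gcongr
      exact norm_radialRetraction_le hR _)) x₀
  refine ⟨α, h0, fun t ht => ?_⟩
  have hα : ∀ t, |t| < T → ‖α t - x₀‖ ≤ R := fun t ht => by
    have key : ∀ {β β' : ℝ → E} {t : ℝ}, 0 ≤ t → t < T → β 0 = x₀ →
        (∀ s ∈ Icc 0 t, HasDerivAt β (β' s) s) →
        (∀ s ∈ Icc 0 t, ‖β' s‖ ≤ K * ‖β s - x₀‖ + C) → ‖β t - x₀‖ ≤ R := by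
      intro β β' t h1 h2 h3 h4 h5
      have := norm_le_gronwallBound_of_norm_deriv_right_le (f := fun s => β s - x₀) (f' := β')
        (δ := 0) (K := K) (ε := C) (a := 0) (b := t)
        (fun s hs => ((h4 s hs).continuousAt.continuousWithinAt).sub continuousWithinAt_const)
        (fun s hs => ((h4 s (Ico_subset_Icc_self hs)).sub_const x₀).hasDerivWithinAt)
        (by simp [h3]) (fun s hs => h5 s (Ico_subset_Icc_self hs)) t ⟨h1, le_rfl⟩
      refine this.trans ?_
      have hm := gronwallBound_mono le_rfl hC0 K.2 (show t - 0 ≤ T by linarith)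
      exact hm.trans (le_add_of_nonneg_right zero_le_one)
    have hbd : ∀ t, |t| < T → ‖u t (α t)‖ ≤ K * ‖α t - x₀‖ + C := fun t ht => by
      refine (hb t (abs_le.1 ht.le) _).trans ?_
      rw [add_comm]
      gcongr
      exact norm_radialRetraction_le_norm hR _
    rcases le_total 0 t with hs | hs
    · rw [abs_of_nonneg hs] at ht
      have hl : ∀ s ∈ Icc 0 t, |s| < T := fun s h => by
        rw [abs_of_nonneg h.1]; exact h.2.trans_lt ht
      exact key hs ht h0 (fun s h' => h s (hl s h')) (fun s h' => hbd s (hl s h'))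
    · rw [abs_of_nonpos hs] at ht
      have hl : ∀ s ∈ Icc 0 (-t), |-s| < T := fun s h => by
        rw [abs_neg, abs_of_nonneg h.1]; exact h.2.trans_lt ht
      have := key (β := fun s => α (-s)) (β' := fun s => -u (-s) (α (-s))) (t := -t)
        (by linarith) ht (by simpa using h0)
        (fun s h' => (h _ (hl s h')).comp_neg_arg)
        (fun s h' => by simpa using hbd _ (hl s h'))
      simpa using this
  have := h t ht
  simpa [u, radialRetraction_of_norm_le hR (hα t ht)] using this

/-- Global existence for time-dependent Lipschitz vector fields. -/
theorem exists_hasDerivAt_of_lipschitz {v : ℝ → E → E} {K : ℝ≥0}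
    (hv : ∀ t, LipschitzWith K (v t)) (hc : ∀ x, Continuous fun t => v t x) (x₀ : E) :
    ∃ α : ℝ → E, α 0 = x₀ ∧ ∀ t, HasDerivAt α (v t (α t)) t := by
  choose α h0 h using fun n : ℕ =>
    exists_hasDerivAt_of_lipschitz_of_lt hv hc (T := (n : ℝ) + 1) (by positivity) x₀
  have huniq : ∀ m n : ℕ, m ≤ n → ∀ t, |t| < (m : ℝ) + 1 → α m t = α n t := fun m n hmn t ht =>
    eq_of_hasDerivAt_of_lipschitz hv (h m) (fun s hs => h n s (hs.trans_le (by gcongr)))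
      (by rw [h0, h0]) ht
  have heq : ∀ (n : ℕ) t, |t| < (n : ℝ) + 1 → α ⌈|t|⌉₊ t = α n t := fun n t ht => by
    rcases le_total ⌈|t|⌉₊ n with hn | hn
    · exact huniq _ _ hn t (by linarith [Nat.le_ceil |t|])
    · exact (huniq _ _ hn t ht).symm
  -- The solution with index `n` lives on `|t| < n + 1`, so index `⌈|t|⌉₊` covers a neighbourhood of
  -- `t`, where all available solutions agree.
  refine ⟨fun t => α ⌈|t|⌉₊ t, by simp [h0], fun t => ?_⟩
  have ht : |t| < (⌈|t|⌉₊ : ℝ) + 1 := by linarith [Nat.le_ceil |t|]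
  refine (h _ t ht).congr_of_eventuallyEq ?_
  filter_upwards [(isOpen_lt continuous_abs continuous_const).mem_nhds ht] with s hs
  exact heq _ s hs

end ODE

/-! ### Global flows and their `C^1` dependence on the initial point. -/

section Flow

open scoped NNReal Topology

variable {E : Type*} [NormedAddCommGroup E] [NormedSpace ℝ E]

/-- `φ` is the global flow of the vector field `V`. -/
structure IsGlobalFlow (V : E → E) (φ : ℝ → E → E) : Prop where
  zero : ∀ x, φ 0 x = x
  hasDerivAt : ∀ t x, HasDerivAt (fun s => φ s x) (V (φ t x)) t

theorem exists_isGlobalFlow [CompleteSpace E] {V : E → E} {K : ℝ≥0} (hV : LipschitzWith K V) :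
    ∃ φ, IsGlobalFlow V φ := by
  choose α h0 h using exists_hasDerivAt_of_lipschitz (v := fun _ => V) (fun _ => hV)
    (fun x => continuous_const)
  exact ⟨fun t x => α x t, h0, fun t x => h x t⟩

namespace IsGlobalFlow

variable {V : E → E} {φ : ℝ → E → E} {K : ℝ≥0}

theorem eq_of_hasDerivAt (hφ : IsGlobalFlow V φ) (hV : LipschitzWith K V) {α : ℝ → E}
    (hα : ∀ t, HasDerivAt α (V (α t)) t) (t : ℝ) : α t = φ t (α 0) :=
  eq_of_hasDerivAt_of_lipschitz (v := fun _ => V) (T := |t| + 1) (fun _ => hV)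
    (fun s _ => hα s) (fun s _ => hφ.hasDerivAt s _) (hφ.zero _).symm (lt_add_one _)

theorem add (hφ : IsGlobalFlow V φ) (hV : LipschitzWith K V) (s t : ℝ) (x : E) :
    φ (t + s) x = φ t (φ s x) := by
  have := hφ.eq_of_hasDerivAt hV (α := fun t => φ (t + s) x)
    (fun t => (hφ.hasDerivAt (t + s) x).comp_add_const t s) t
  simpa using this

theorem neg_apply_apply (hφ : IsGlobalFlow V φ) (hV : LipschitzWith K V) (t : ℝ) (x : E) :
    φ (-t) (φ t x) = x := by
  rw [← hφ.add hV, neg_add_cancel, hφ.zero]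

theorem dist_le (hφ : IsGlobalFlow V φ) (hV : LipschitzWith K V) (t : ℝ) (x y : E) :
    dist (φ t x) (φ t y) ≤ dist x y * Real.exp (K * |t|) := by
  have := dist_le_gronwallBound_abs (v := fun _ => V) (T := |t| + 1) (fun _ => hV) (ε := 0)
    (fun s _ => hφ.hasDerivAt s x) (fun s _ => by simp) (fun s _ => hφ.hasDerivAt s y)
    (δ := dist x y) (by rw [hφ.zero, hφ.zero]) (lt_add_one _)
  rwa [gronwallBound_ε0] at this

theorem continuous (hφ : IsGlobalFlow V φ) (hV : LipschitzWith K V) :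
    Continuous fun p : ℝ × E => φ p.1 p.2 := by
  rw [continuous_iff_continuousAt]
  rintro ⟨t₀, x₀⟩
  have h1 : Filter.Tendsto (fun p : ℝ × E => φ p.1 x₀) (𝓝 (t₀, x₀)) (𝓝 (φ t₀ x₀)) :=
    ((hφ.hasDerivAt t₀ x₀).continuousAt.tendsto).comp continuous_fst.continuousAt
  refine h1.congr_dist ?_
  have h2 : Filter.Tendsto (fun p : ℝ × E => dist x₀ p.2 * Real.exp (K * |p.1|))
      (𝓝 (t₀, x₀)) (𝓝 0) := by
    have : Continuous fun p : ℝ × E => dist x₀ p.2 * Real.exp (K * |p.1|) := by fun_prop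
    simpa using this.tendsto (t₀, x₀)
  exact squeeze_zero (fun _ => dist_nonneg) (fun p => hφ.dist_le hV _ _ _) h2

/-- The solution of the variational equation along a `C^1` flow is the spatial derivative of the
flow, and depends continuously on time and initial point. -/
theorem exists_hasFDerivAt [CompleteSpace E] (hφ : IsGlobalFlow V φ) (hV : LipschitzWith K V)
    (hV1 : ContDiff ℝ 1 V) :
    ∃ J : ℝ → E → E →L[ℝ] E, (∀ x, J 0 x = ContinuousLinearMap.id ℝ E) ∧
      (∀ t x, HasDerivAt (fun s => J s x) ((fderiv ℝ V (φ t x)).comp (J t x)) t) ∧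
      (∀ t x, HasFDerivAt (φ t) (J t x) x) ∧ Continuous fun p : ℝ × E => J p.1 p.2 := by
  have hD : Continuous (fderiv ℝ V) := hV1.continuous_fderiv one_ne_zero
  have hc := hφ.continuous hV
  have hφt : ∀ x, Continuous fun t => φ t x := fun x =>
    hc.comp (continuous_id.prodMk continuous_const)
  have hlip : ∀ x, ∀ t, LipschitzWith K fun A : E →L[ℝ] E => (fderiv ℝ V (φ t x)).comp A :=
    fun x t => LipschitzWith.of_dist_le_mul fun A B => by
      rw [dist_eq_norm, dist_eq_norm, ← ContinuousLinearMap.comp_sub]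
      refine (ContinuousLinearMap.opNorm_comp_le _ _).trans ?_
      gcongr
      exact norm_fderiv_le_of_lipschitz ℝ hV
  choose J' hJ0 hJ' using fun x => exists_hasDerivAt_of_lipschitz (hlip x)
    (fun A => ((hD.comp (hφt x)).clm_comp continuous_const)) (ContinuousLinearMap.id ℝ E)
  set J : ℝ → E → E →L[ℝ] E := fun t x => J' x t with hJdef
  have hJ : ∀ t x, HasDerivAt (fun s => J s x) ((fderiv ℝ V (φ t x)).comp (J t x)) t :=
    fun t x => hJ' x t
  have hJc : ∀ x, Continuous fun t => J t x := fun x =>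
    continuous_iff_continuousAt.2 fun t => (hJ t x).continuousAt
  refine ⟨J, hJ0, hJ, fun t x => ?_, ?_⟩
  · set T := |t| + 1 with hT
    obtain ⟨C, hC⟩ := (isCompact_Icc (a := -T) (b := T)).exists_bound_of_continuousOn
      (hJc x).continuousOn
    have hC0 : 0 ≤ C := (norm_nonneg _).trans (hC 0 ⟨by rw [hT]; linarith [abs_nonneg t], by positivity⟩)
    set G := gronwallBound 0 K 1 |t| with hG
    have hG0 : 0 ≤ G := gronwallBound_zero_one_nonneg K.2 (abs_nonneg t)
    rw [hasFDerivAt_iff_isLittleO_nhds_zero, Asymptotics.isLittleO_iff]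
    intro c hc0
    -- Grönwall will return the error `ε * C * G * ‖h‖`; adding 1 to each factor makes it at most `c
    -- * ‖h‖` even when `C` or `G` vanishes.
    set ε := c / ((C + 1) * (G + 1)) with hε
    have hε0 : 0 < ε := by positivity
    have htube : ∀ᶠ k in 𝓝 (0 : E), ∀ s ∈ Icc (-T) T,
        ‖fderiv ℝ V (φ s x + k) - fderiv ℝ V (φ s x)‖ < ε := by
      refine isCompact_Icc.eventually_forall_of_forall_eventually fun s _ => ?_
      have hcont : Continuous fun z : E × ℝ =>
          ‖fderiv ℝ V (φ z.2 x + z.1) - fderiv ℝ V (φ z.2 x)‖ :=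
        ((hD.comp (((hφt x).comp continuous_snd).add continuous_fst)).sub
          (hD.comp ((hφt x).comp continuous_snd))).norm
      exact hcont.continuousAt.eventually_lt continuousAt_const (by simpa using hε0)
    obtain ⟨r, hr, hball⟩ := Metric.eventually_nhds_iff_ball.1 htube
    have hsmall : ∀ᶠ h in 𝓝 (0 : E), C * ‖h‖ < r := by
      have : Continuous fun h : E => C * ‖h‖ := by fun_prop
      exact this.continuousAt.eventually_lt continuousAt_const (by simpa using hr)
    filter_upwards [hsmall] with h hh
    have hJh : ∀ s, |s| < T → ‖J s x h‖ ≤ C * ‖h‖ := fun s hs =>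
      (ContinuousLinearMap.le_opNorm _ _).trans (by gcongr; exact hC s (abs_le.1 hs.le))
    -- The linearised curve `φ s x + J s x h` solves the ODE up to an error `o(‖h‖)`, so Grönwall
    -- compares it with the true trajectory from `x + h`.
    have happrox : ∀ s, |s| < T → dist (V (φ s x) + (fderiv ℝ V (φ s x)) (J s x h))
        (V (φ s x + J s x h)) ≤ ε * (C * ‖h‖) := by
      intro s hs
      have := (convex_ball (φ s x) r).norm_image_sub_le_of_norm_hasFDerivWithin_le'
        (f := V) (f' := fderiv ℝ V) (φ := fderiv ℝ V (φ s x)) (C := ε) (x := φ s x)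
        (y := φ s x + J s x h)
        (fun z _ => (hV1.differentiable one_ne_zero z).hasFDerivAt.hasFDerivWithinAt)
        (fun z hz => by
          have := hball (z - φ s x) (by simpa [dist_eq_norm] using hz) s (abs_le.1 hs.le)
          rw [add_sub_cancel] at this
          exact this.le) (Metric.mem_ball_self hr)
        (by simpa [dist_eq_norm] using (hJh s hs).trans_lt hh)
      rw [add_sub_cancel_left] at this
      rw [dist_comm, dist_eq_norm, ← sub_sub]
      refine this.trans ?_
      gcongr
      exact hJh s hs
    have := dist_le_gronwallBound_abs (v := fun _ => V) (T := T) (fun _ => hV)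
      (f := fun s => φ s x + J s x h) (g := fun s => φ s (x + h))
      (f' := fun s => V (φ s x) + (fderiv ℝ V (φ s x)) (J s x h)) (δ := 0)
      (fun s _ => (hφ.hasDerivAt s x).add (by
        simpa using (hJ s x).clm_apply (hasDerivAt_const s h)))
      happrox (fun s _ => hφ.hasDerivAt s _) (by
        simp [hφ.zero, hJdef, hJ0]) (t := t) (lt_add_one _)
    rw [gronwallBound_eq_add, zero_mul, zero_add, dist_comm, dist_eq_norm, ← sub_sub] at this
    refine this.trans ?_
    have h1 : ε * (C * ‖h‖) * G = c * ‖h‖ * ((C / (C + 1)) * (G / (G + 1))) := by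
      rw [hε]; field_simp
    rw [← hG, h1]
    refine mul_le_of_le_one_right (by positivity) (mul_le_one₀ ?_ (by positivity) ?_)
    · exact (div_le_one (by positivity)).2 (by linarith)
    · exact (div_le_one (by positivity)).2 (by linarith)
  · rw [continuous_iff_continuousAt]
    rintro ⟨t₀, x₀⟩
    have h1 : Filter.Tendsto (fun p : ℝ × E => J p.1 x₀) (𝓝 (t₀, x₀)) (𝓝 (J t₀ x₀)) :=
      ((hJc x₀).continuousAt.tendsto).comp continuous_fst.continuousAt
    refine h1.congr_dist ?_
    set T := |t₀| + 1 with hT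
    have hT0 : 0 ≤ T := by positivity
    set G := gronwallBound 0 K 1 T with hG
    have hG0 : 0 ≤ G := gronwallBound_zero_one_nonneg K.2 hT0
    rw [Metric.tendsto_nhds]
    intro c hc0
    set ε := c / (G + 1) with hε
    have hε0 : 0 < ε := by positivity
    -- For `y` near `x₀`, `J s x₀` almost solves the variational equation along the trajectory of
    -- `y`, uniformly in `s`.
    have htube : ∀ᶠ y in 𝓝 x₀, ∀ s ∈ Icc (-T) T,
        ‖(fderiv ℝ V (φ s x₀)).comp (J s x₀) - (fderiv ℝ V (φ s y)).comp (J s x₀)‖ < ε := by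
      refine isCompact_Icc.eventually_forall_of_forall_eventually fun s _ => ?_
      have hcont : Continuous fun z : E × ℝ => ‖(fderiv ℝ V (φ z.2 x₀)).comp (J z.2 x₀)
          - (fderiv ℝ V (φ z.2 z.1)).comp (J z.2 x₀)‖ := by
        have hJ2 : Continuous fun z : E × ℝ => J z.2 x₀ := (hJc x₀).comp continuous_snd
        exact (((hD.comp ((hφt x₀).comp continuous_snd)).clm_comp hJ2).sub
          ((hD.comp (hc.comp continuous_swap)).clm_comp hJ2)).norm
      exact hcont.continuousAt.eventually_lt continuousAt_const (by simpa using hε0)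
    have ht : ∀ᶠ t in 𝓝 t₀, |t| < T :=
      (continuous_abs.continuousAt).eventually_lt continuousAt_const (lt_add_one _)
    rw [nhds_prod_eq]
    filter_upwards [ht.prod_mk htube] with p hp
    have := dist_le_gronwallBound_abs (T := T) (hlip p.2)
      (f := fun s => J s x₀) (g := fun s => J s p.2) (ε := ε) (δ := 0)
      (fun s _ => hJ s x₀) (fun s hs => by
        rw [dist_eq_norm]; exact (hp.2 s (abs_le.1 hs.le)).le)
      (fun s _ => hJ s p.2) (by simp [hJdef, hJ0]) hp.1
    rw [gronwallBound_eq_add, zero_mul, zero_add] at this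
    have h2 : gronwallBound 0 K 1 |p.1| ≤ G := gronwallBound_mono le_rfl zero_le_one K.2 hp.1.le
    rw [Real.dist_eq, sub_zero, abs_of_nonneg dist_nonneg]
    calc _ ≤ ε * G := this.trans (by gcongr)
      _ < ε * (G + 1) := by gcongr; exact lt_add_one _
      _ = c := by rw [hε]; field_simp

/-- The global flow of a `C^1` Lipschitz vector field is jointly `C^1`. -/
theorem contDiff [CompleteSpace E] (hφ : IsGlobalFlow V φ) (hV : LipschitzWith K V)
    (hV1 : ContDiff ℝ 1 V) : ContDiff ℝ 1 fun p : ℝ × E => φ p.1 p.2 := by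
  obtain ⟨J, -, -, hJ, hJc⟩ := hφ.exists_hasFDerivAt hV hV1
  have hc : Continuous fun p : ℝ × E =>
      (ContinuousLinearMap.toSpanSingleton ℝ (V (φ p.1 p.2))) :=
    (ContinuousLinearMap.toSpanSingletonCLE (𝕜 := ℝ) (E := E)).continuous.comp
      (hV.continuous.comp (hφ.continuous hV))
  refine contDiff_one_iff_hasFDerivAt.2 ⟨fun p =>
    (ContinuousLinearMap.toSpanSingleton ℝ (V (φ p.1 p.2))).coprod (J p.1 p.2), ?_, fun p => ?_⟩
  · exact hc.continuousLinearMapCoprod hJc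
  · exact (hasStrictFDerivAt_uncurry_coprod (f := φ) (u := p)
      (f₁ := fun t x => ContinuousLinearMap.toSpanSingleton ℝ (V (φ t x))) (f₂ := J)
      (Filter.Eventually.of_forall fun v => (hφ.hasDerivAt v.1 v.2).hasFDerivAt)
      (Filter.Eventually.of_forall fun v => hJ v.1 v.2)
      hc.continuousAt hJc.continuousAt).hasFDerivAt

end IsGlobalFlow

end Flow

/-! ### Linear transport equations by characteristics. -/

section Transport

open scoped NNReal Topology

theorem HasDerivAt.fst' {F G : Type*} [NormedAddCommGroup F] [NormedSpace ℝ F]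
    [NormedAddCommGroup G] [NormedSpace ℝ G] {f : ℝ → F × G} {f' : F × G} {s : ℝ}
    (h : HasDerivAt f f' s) : HasDerivAt (fun s => (f s).1) f'.1 s :=
  (ContinuousLinearMap.fst ℝ F G).hasFDerivAt.comp_hasDerivAt s h

theorem HasDerivAt.snd' {F G : Type*} [NormedAddCommGroup F] [NormedSpace ℝ F]
    [NormedAddCommGroup G] [NormedSpace ℝ G] {f : ℝ → F × G} {f' : F × G} {s : ℝ}
    (h : HasDerivAt f f' s) : HasDerivAt (fun s => (f s).2) f'.2 s :=
  (ContinuousLinearMap.snd ℝ F G).hasFDerivAt.comp_hasDerivAt s h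

/-- The characteristic vector field on points `(t, θ, x, m)` of a transport equation in `x` with
velocity `a` and divergence `c`. -/
def characteristicField (a c : ℝ × ℝ × ℝ → ℝ) (z : ℝ × ℝ × ℝ × ℝ) : ℝ × ℝ × ℝ × ℝ :=
  (1, 0, a (z.1, z.2.1, z.2.2.1), c (z.1, z.2.1, z.2.2.1))

section

variable {a c : ℝ × ℝ × ℝ → ℝ} {φ : ℝ → ℝ × ℝ × ℝ × ℝ → ℝ × ℝ × ℝ × ℝ} {Ka Kc K : ℝ≥0}

theorem exists_lipschitzWith_characteristicField (ha : LipschitzWith Ka a)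
    (hc : LipschitzWith Kc c) : ∃ K, LipschitzWith K (characteristicField a c) := by
  have hp : LipschitzWith 1 fun z : ℝ × ℝ × ℝ × ℝ => (z.1, z.2.1, z.2.2.1) := by
    refine LipschitzWith.of_dist_le_mul fun z z' => ?_
    simp only [Prod.dist_eq, NNReal.coe_one, one_mul]
    exact max_le_max le_rfl (max_le_max le_rfl (le_max_left _ _))
  exact ⟨_, (LipschitzWith.const 1).prodMk ((LipschitzWith.const 0).prodMk
    ((ha.comp hp).prodMk (hc.comp hp)))⟩

theorem contDiff_characteristicField (ha : ContDiff ℝ 1 a) (hc : ContDiff ℝ 1 c) :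
    ContDiff ℝ 1 (characteristicField a c) := by
  unfold characteristicField
  fun_prop

theorem IsGlobalFlow.fst_characteristic (hφ : IsGlobalFlow (characteristicField a c) φ) (s : ℝ)
    (z : ℝ × ℝ × ℝ × ℝ) : (φ s z).1 = z.1 + s := by
  have h : ∀ s, HasDerivAt (fun s => (φ s z).1 - s) 0 s := fun s => by
    simpa [characteristicField] using! ((hφ.hasDerivAt s z).fst').sub (hasDerivAt_id s)
  have := is_const_of_deriv_eq_zero (fun s => (h s).differentiableAt) (fun s => (h s).deriv) s 0
  simp only [hφ.zero, sub_zero] at this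
  linarith

theorem IsGlobalFlow.snd_characteristic (hφ : IsGlobalFlow (characteristicField a c) φ) (s : ℝ)
    (z : ℝ × ℝ × ℝ × ℝ) : (φ s z).2.1 = z.2.1 := by
  have h : ∀ s, HasDerivAt (fun s => (φ s z).2.1) 0 s := fun s => by
    simpa [characteristicField] using (hφ.hasDerivAt s z).snd'.fst'
  have := is_const_of_deriv_eq_zero (fun s => (h s).differentiableAt) (fun s => (h s).deriv) s 0
  simpa only [hφ.zero] using this

/-- The field does not depend on the last coordinate, so translations in it commute with the flow.
-/
theorem IsGlobalFlow.characteristic_add (hφ : IsGlobalFlow (characteristicField a c) φ)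
    (hV : LipschitzWith K (characteristicField a c)) (s μ : ℝ) (z : ℝ × ℝ × ℝ × ℝ) :
    φ s (z + (0, 0, 0, μ)) = φ s z + (0, 0, 0, μ) := by
  have := hφ.eq_of_hasDerivAt hV (α := fun s => φ s z + (0, 0, 0, μ)) (fun s => by
    simpa [characteristicField] using (hφ.hasDerivAt s z).add_const (0, 0, 0, μ)) s
  rw [this, hφ.zero]

/-- The solution of the linear transport equation obtained by following characteristics. -/
noncomputable def transportSolution (φ : ℝ → ℝ × ℝ × ℝ × ℝ → ℝ × ℝ × ℝ × ℝ) (f₀ : ℝ × ℝ → ℝ)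
    (t θ x : ℝ) : ℝ :=
  f₀ (θ, (φ (-t) (t, θ, x, 0)).2.2.1) * Real.exp (φ (-t) (t, θ, x, 0)).2.2.2

theorem contDiff_transportSolution {f₀ : ℝ × ℝ → ℝ} (hf₀ : ContDiff ℝ 1 f₀)
    (hφ : ContDiff ℝ 1 fun p : ℝ × ℝ × ℝ × ℝ × ℝ => φ p.1 p.2) :
    ContDiff ℝ 1 fun p : ℝ × ℝ × ℝ => transportSolution φ f₀ p.1 p.2.1 p.2.2 := by
  have h : ContDiff ℝ 1 fun p : ℝ × ℝ × ℝ => φ (-p.1) (p.1, p.2.1, p.2.2, 0) :=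
    hφ.comp (g := fun p : ℝ × ℝ × ℝ × ℝ × ℝ => φ p.1 p.2)
      (f := fun p : ℝ × ℝ × ℝ => (-p.1, p.1, p.2.1, p.2.2, 0)) (by fun_prop)
  unfold transportSolution
  exact (hf₀.comp ((contDiff_fst.comp contDiff_snd).prodMk
    (contDiff_fst.comp (contDiff_snd.comp (contDiff_snd.comp h))))).mul
    (contDiff_snd.comp (contDiff_snd.comp (contDiff_snd.comp h))).exp

theorem transportSolution_zero (hφ : IsGlobalFlow (characteristicField a c) φ)
    (f₀ : ℝ × ℝ → ℝ) (θ x : ℝ) : transportSolution φ f₀ 0 θ x = f₀ (θ, x) := by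
  simp [transportSolution, hφ.zero]

/-- Along a characteristic the solution is damped by the exponential of the accumulated divergence.
The derivative at `s = 0` yields the equation; the case `t = 0` says that density times Jacobian is
conserved. -/
theorem transportSolution_add (hφ : IsGlobalFlow (characteristicField a c) φ)
    (hV : LipschitzWith K (characteristicField a c)) (f₀ : ℝ × ℝ → ℝ) (s t θ x : ℝ) :
    transportSolution φ f₀ (t + s) θ (φ s (t, θ, x, 0)).2.2.1
      = transportSolution φ f₀ t θ x * Real.exp (-(φ s (t, θ, x, 0)).2.2.2) := by
  set z : ℝ × ℝ × ℝ × ℝ := (t, θ, x, 0) with hz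
  -- Resetting the accumulated divergence to 0 is a translation in the last coordinate, which the
  -- flow ignores.
  have e : ((t + s, θ, (φ s z).2.2.1, 0) : ℝ × ℝ × ℝ × ℝ)
      = φ s z + (0, 0, 0, -(φ s z).2.2.2) := by
    have h1 := hφ.fst_characteristic s z
    have h2 := hφ.snd_characteristic s z
    rw [hz] at h1 h2
    ext <;> simp [h1, h2, hz]
  have e2 : φ (-(t + s)) (t + s, θ, (φ s z).2.2.1, 0)
      = φ (-t) z + (0, 0, 0, -(φ s z).2.2.2) := by
    rw [e, hφ.characteristic_add hV, ← hφ.add hV]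
    congr 2
    ring
  simp only [transportSolution, e2, ← hz, Prod.fst_add, Prod.snd_add, add_zero, Real.exp_add]
  ring

theorem transportSolution_equation (hφ : IsGlobalFlow (characteristicField a c) φ)
    (hV : LipschitzWith K (characteristicField a c)) {f₀ : ℝ × ℝ → ℝ}
    (hf : ContDiff ℝ 1 fun p : ℝ × ℝ × ℝ => transportSolution φ f₀ p.1 p.2.1 p.2.2)
    (t θ x : ℝ) :
    deriv (fun s => transportSolution φ f₀ s θ x) t
      + (a (t, θ, x) * deriv (fun y => transportSolution φ f₀ t θ y) x
        + c (t, θ, x) * transportSolution φ f₀ t θ x) = 0 := by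
  set f := transportSolution φ f₀ with hfdef
  set F : ℝ × ℝ × ℝ → ℝ := fun p => f p.1 p.2.1 p.2.2 with hF
  have hD : HasFDerivAt F (fderiv ℝ F (t, θ, x)) (t, θ, x) :=
    (hf.differentiable one_ne_zero _).hasFDerivAt
  have ht : HasDerivAt (fun s => f s θ x) (fderiv ℝ F (t, θ, x) (1, 0, 0)) t :=
    HasFDerivAt.comp_hasDerivAt (f := fun s : ℝ => (s, θ, x)) t hD
      ((hasDerivAt_id t).prodMk ((hasDerivAt_const t θ).prodMk (hasDerivAt_const t x)))
  have hx : HasDerivAt (fun y => f t θ y) (fderiv ℝ F (t, θ, x) (0, 0, 1)) x :=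
    HasFDerivAt.comp_hasDerivAt (f := fun y : ℝ => (t, θ, y)) x hD
      ((hasDerivAt_const x t).prodMk ((hasDerivAt_const x θ).prodMk (hasDerivAt_id x)))
  have hφ0 := hφ.hasDerivAt 0 (t, θ, x, 0)
  rw [hφ.zero] at hφ0
  have hX : HasDerivAt (fun s => (φ s (t, θ, x, 0)).2.2.1) (a (t, θ, x)) 0 := hφ0.snd'.snd'.fst'
  have hm : HasDerivAt (fun s => (φ s (t, θ, x, 0)).2.2.2) (c (t, θ, x)) 0 := hφ0.snd'.snd'.snd'
  have h1 : HasDerivAt (fun s => f (t + s) θ (φ s (t, θ, x, 0)).2.2.1)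
      (fderiv ℝ F (t, θ, x) (1, 0, a (t, θ, x))) 0 := by
    refine HasFDerivAt.comp_hasDerivAt (l := F)
      (f := fun s : ℝ => (t + s, θ, (φ s (t, θ, x, 0)).2.2.1)) 0 ?_
      (((hasDerivAt_id (0 : ℝ)).const_add t).prodMk ((hasDerivAt_const 0 θ).prodMk hX))
    simpa [hφ.zero] using hD
  have h2 : HasDerivAt (fun s => f t θ x * Real.exp (-(φ s (t, θ, x, 0)).2.2.2))
      (f t θ x * (-c (t, θ, x))) 0 := by
    simpa [hφ.zero] using hm.neg.exp.const_mul (f t θ x)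
  have h3 := h1.unique (h2.congr_of_eventuallyEq
    (Filter.Eventually.of_forall fun s => transportSolution_add hφ hV f₀ s t θ x))
  have h4 : ((1, 0, a (t, θ, x)) : ℝ × ℝ × ℝ)
      = (1, 0, 0) + a (t, θ, x) • ((0, 0, 1) : ℝ × ℝ × ℝ) := by ext <;> simp
  rw [h4, map_add, map_smul, smul_eq_mul] at h3
  rw [ht.deriv, hx.deriv]
  linarith

/-- The inverse follows the characteristic backwards from time `t`; the value of the last coordinate
there has no effect on the position. -/
theorem bijective_characteristic (hφ : IsGlobalFlow (characteristicField a c) φ)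
    (hV : LipschitzWith K (characteristicField a c)) (t θ : ℝ) :
    Function.Bijective fun r => (φ t (0, θ, r, 0)).2.2.1 := by
  have key : ∀ s r x, (φ (-s) (φ s (r, θ, x, 0) + (0, 0, 0, -(φ s (r, θ, x, 0)).2.2.2))).2.2.1
      = x := fun s r x => by
    rw [hφ.characteristic_add hV, hφ.neg_apply_apply hV]; simp
  have key2 : ∀ s r x, φ s (r, θ, x, 0) + (0, 0, 0, -(φ s (r, θ, x, 0)).2.2.2)
      = (r + s, θ, (φ s (r, θ, x, 0)).2.2.1, 0) := fun s r x => by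
    have h1 := hφ.fst_characteristic s (r, θ, x, 0)
    have h2 := hφ.snd_characteristic s (r, θ, x, 0)
    ext <;> simp [h1, h2]
  refine ⟨fun r r' h => ?_, fun x => ⟨(φ (-t) (t, θ, x, 0)).2.2.1, ?_⟩⟩
  · have h1 := key t 0 r
    have h2 := key t 0 r'
    rw [key2] at h1 h2
    dsimp only at h
    rw [← h1, ← h2, h]
  · have h1 := key (-t) t x
    rw [key2, neg_neg] at h1
    simpa using h1

/-- Liouville's formula: the `x`-component `j` of the variational solution satisfies `j' = (∂ₓ a) j
= c j`, while the last coordinate `m` of the flow has `m' = c`. Hence `j * exp (-m)` keeps its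
initial value 1. -/
theorem hasDerivAt_characteristic (hφ : IsGlobalFlow (characteristicField a c) φ)
    (hV : LipschitzWith K (characteristicField a c))
    (hV1 : ContDiff ℝ 1 (characteristicField a c)) (ha : ContDiff ℝ 1 a)
    (hac : ∀ t θ x, HasDerivAt (fun y => a (t, θ, y)) (c (t, θ, x)) x) (t θ r : ℝ) :
    HasDerivAt (fun r => (φ t (0, θ, r, 0)).2.2.1)
      (Real.exp (φ t (0, θ, r, 0)).2.2.2) r := by
  obtain ⟨J, hJ0, hJ, hJd, -⟩ := hφ.exists_hasFDerivAt hV hV1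
  set z : ℝ × ℝ × ℝ × ℝ := (0, θ, r, 0) with hz
  set e : ℝ × ℝ × ℝ × ℝ := (0, 0, 1, 0) with he
  have hlin : HasDerivAt (fun r : ℝ => ((0, θ, r, 0) : ℝ × ℝ × ℝ × ℝ)) e r :=
    (hasDerivAt_const r _).prodMk ((hasDerivAt_const r _).prodMk
      ((hasDerivAt_id r).prodMk (hasDerivAt_const r _)))
  have hfirst : HasDerivAt (fun r => (φ t (0, θ, r, 0)).2.2.1) (J t z e).2.2.1 r :=
    (HasFDerivAt.comp_hasDerivAt (f := fun r : ℝ => ((0, θ, r, 0) : ℝ × ℝ × ℝ × ℝ)) r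
      (hJd t z) hlin).snd'.snd'.fst'
  have hJe : ∀ s, HasDerivAt (fun s => J s z e)
      (fderiv ℝ (characteristicField a c) (φ s z) (J s z e)) s := fun s => by
    simpa using (hJ s z).clm_apply (hasDerivAt_const s e)
  have hfd : ∀ (w v : ℝ × ℝ × ℝ × ℝ), (fderiv ℝ (characteristicField a c) w v).1 = 0 ∧
      (fderiv ℝ (characteristicField a c) w v).2.1 = 0 ∧
      (fderiv ℝ (characteristicField a c) w v).2.2.1
        = fderiv ℝ a (w.1, w.2.1, w.2.2.1) (v.1, v.2.1, v.2.2.1) := by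
    intro w v
    have hd := (hV1.differentiable one_ne_zero w).hasFDerivAt
    have hl : HasDerivAt (fun s : ℝ => w + s • v) v 0 := by
      simpa using ((hasDerivAt_id (0 : ℝ)).smul_const v).const_add w
    have hd' : HasFDerivAt (characteristicField a c)
        (fderiv ℝ (characteristicField a c) w) (w + (0 : ℝ) • v) := by simpa using hd
    have h0 := hd'.comp_hasDerivAt 0 hl
    refine ⟨?_, ?_, ?_⟩
    · exact h0.fst'.unique (hasDerivAt_const _ _)
    · exact h0.snd'.fst'.unique (hasDerivAt_const _ _)
    · refine h0.snd'.snd'.fst'.unique ?_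
      have hda : HasFDerivAt a (fderiv ℝ a (w.1, w.2.1, w.2.2.1))
          (((w + (0 : ℝ) • v).1, (w + (0 : ℝ) • v).2.1, (w + (0 : ℝ) • v).2.2.1)) := by
        simpa using (ha.differentiable one_ne_zero (w.1, w.2.1, w.2.2.1)).hasFDerivAt
      exact HasFDerivAt.comp_hasDerivAt
        (f := fun s : ℝ => ((w + s • v).1, (w + s • v).2.1, (w + s • v).2.2.1)) 0 hda
        (hl.fst'.prodMk (hl.snd'.fst'.prodMk hl.snd'.snd'.fst'))
  have h1 : ∀ s, (J s z e).1 = 0 := fun s => by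
    have h : ∀ s, HasDerivAt (fun s => (J s z e).1) 0 s := fun s => by
      have := (hJe s).fst'
      rwa [(hfd _ _).1] at this
    have := is_const_of_deriv_eq_zero (fun s => (h s).differentiableAt) (fun s => (h s).deriv) s 0
    simpa [hJ0, he] using this
  have h2 : ∀ s, (J s z e).2.1 = 0 := fun s => by
    have h : ∀ s, HasDerivAt (fun s => (J s z e).2.1) 0 s := fun s => by
      have := (hJe s).snd'.fst'
      rwa [(hfd _ _).2.1] at this
    have := is_const_of_deriv_eq_zero (fun s => (h s).differentiableAt) (fun s => (h s).deriv) s 0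
    simpa [hJ0, he] using this
  set C : ℝ → ℝ := fun s => c ((φ s z).1, (φ s z).2.1, (φ s z).2.2.1) with hC
  have h3 : ∀ s, HasDerivAt (fun s => (J s z e).2.2.1) (C s * (J s z e).2.2.1) s := fun s => by
    have := (hJe s).snd'.snd'.fst'
    rw [(hfd _ _).2.2, h1, h2] at this
    convert! this using 1
    have hda := (ha.differentiable one_ne_zero
      ((φ s z).1, (φ s z).2.1, (φ s z).2.2.1)).hasFDerivAt
    have h4 := HasFDerivAt.comp_hasDerivAt
      (f := fun y : ℝ => ((φ s z).1, (φ s z).2.1, y)) (φ s z).2.2.1 hda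
      ((hasDerivAt_const _ _).prodMk ((hasDerivAt_const _ _).prodMk (hasDerivAt_id _)))
    have h5 := h4.unique (hac _ _ _)
    have h6 : ((0, 0, (J s z e).2.2.1) : ℝ × ℝ × ℝ)
        = (J s z e).2.2.1 • ((0, 0, 1) : ℝ × ℝ × ℝ) := by ext <;> simp
    rw [h6, map_smul, h5, smul_eq_mul, mul_comm]
  have h4 : ∀ s, HasDerivAt (fun s => (φ s z).2.2.2) (C s) s := fun s =>
    (hφ.hasDerivAt s z).snd'.snd'.snd'
  have h5 : ∀ s, HasDerivAt (fun s => (J s z e).2.2.1 * Real.exp (-(φ s z).2.2.2)) 0 s :=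
    fun s => by
      convert! (h3 s).mul (h4 s).neg.exp using 1
      ring
  have h6 := is_const_of_deriv_eq_zero (fun s => (h5 s).differentiableAt)
    (fun s => (h5 s).deriv) t 0
  simp only [hJ0, hφ.zero, hz, he] at h6
  simp only [ContinuousLinearMap.coe_id', id_eq, neg_zero, Real.exp_zero, mul_one] at h6
  convert! hfirst using 1
  rw [Real.exp_neg, ← div_eq_mul_inv, div_eq_one_iff_eq (Real.exp_pos _).ne'] at h6
  exact h6.symm

theorem hasDerivAt_time_characteristic (hφ : IsGlobalFlow (characteristicField a c) φ)
    (t θ r : ℝ) :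
    HasDerivAt (fun t => (φ t (0, θ, r, 0)).2.2.1) (a (t, θ, (φ t (0, θ, r, 0)).2.2.1)) t := by
  have := (hφ.hasDerivAt t (0, θ, r, 0)).snd'.snd'.fst'
  simpa [characteristicField, hφ.fst_characteristic, hφ.snd_characteristic] using this

end

end Transport

/-! ### Differentiation under the integral over a compact set. -/

section ParametricIntegral

open scoped NNReal Topology

variable {H Y : Type*} [NormedAddCommGroup H] [NormedSpace ℝ H] [ProperSpace H]
  [TopologicalSpace Y] [T2Space Y] [MeasurableSpace Y] [BorelSpace Y]
  {μ : Measure Y} [IsLocallyFiniteMeasure μ]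

theorem contDiff_one_setIntegral [SecondCountableTopology Y] {Q : Set Y} (hQ : IsCompact Q) {F : H → Y → ℝ}
    {F' : H → Y → H →L[ℝ] ℝ} (hF : Continuous F.uncurry) (hF' : Continuous F'.uncurry)
    (hd : ∀ z y, HasFDerivAt (fun z => F z y) (F' z y) z) :
    ContDiff ℝ 1 fun z => ∫ y in Q, F z y ∂μ := by
  refine contDiff_one_iff_hasFDerivAt.2 ⟨fun z => ∫ y in Q, F' z y ∂μ,
    continuous_parametric_integral_of_continuous hF' hQ, fun z => ?_⟩
  obtain ⟨C, hC⟩ := ((isCompact_closedBall z 1).prod hQ).exists_bound_of_continuousOn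
    hF'.continuousOn
  have hc : ∀ z, Continuous (F z) := fun z => hF.comp (Continuous.prodMk_right z)
  have hc' : ∀ z, Continuous (F' z) := fun z => hF'.comp (Continuous.prodMk_right z)
  refine hasFDerivAt_integral_of_dominated_of_fderiv_le (s := Metric.closedBall z 1)
    (bound := fun _ => C) (Metric.closedBall_mem_nhds z one_pos)
    (Filter.Eventually.of_forall fun z => (hc z).aestronglyMeasurable)
    ((hc z).continuousOn.integrableOn_compact hQ) (hc' z).aestronglyMeasurable ?_
    (integrableOn_const hQ.measure_lt_top.ne) (Filter.Eventually.of_forall fun y z _ => hd z y)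
  filter_upwards [ae_restrict_mem hQ.measurableSet] with y hy x hx
  exact hC (x, y) ⟨hx, hy⟩

theorem hasDerivAt_setIntegral_of_continuousOn {Q : Set Y} (hQ : IsCompact Q) {s : Set ℝ}
    (hs : IsOpen s) {F F' : ℝ → Y → ℝ} (hF : ContinuousOn F.uncurry (s ×ˢ Q))
    (hF' : ContinuousOn F'.uncurry (s ×ˢ Q))
    (hd : ∀ t ∈ s, ∀ y ∈ Q, HasDerivAt (fun t => F t y) (F' t y) t) {t : ℝ} (ht : t ∈ s) :
    HasDerivAt (fun t => ∫ y in Q, F t y ∂μ) (∫ y in Q, F' t y ∂μ) t := by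
  obtain ⟨ε, hε, hball⟩ := Metric.nhds_basis_closedBall.mem_iff.1 (hs.mem_nhds ht)
  obtain ⟨C, hC⟩ := ((isCompact_closedBall t ε).prod hQ).exists_bound_of_continuousOn
    (hF'.mono (prod_mono hball le_rfl))
  have hc : ∀ t ∈ s, ContinuousOn (F t) Q := fun t ht =>
    hF.comp (Continuous.prodMk_right t).continuousOn fun y hy => ⟨ht, hy⟩
  have hc' : ∀ t ∈ s, ContinuousOn (F' t) Q := fun t ht =>
    hF'.comp (Continuous.prodMk_right t).continuousOn fun y hy => ⟨ht, hy⟩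
  have hQm := hQ.measurableSet
  refine (hasDerivAt_integral_of_dominated_loc_of_deriv_le (s := Metric.closedBall t ε)
    (bound := fun _ => C) (Metric.closedBall_mem_nhds t hε) ?_
    ((hc t ht).integrableOn_compact hQ) ((hc' t ht).aestronglyMeasurable hQm) ?_
    (integrableOn_const hQ.measure_lt_top.ne) ?_).2
  · filter_upwards [hs.mem_nhds ht] with t ht using (hc t ht).aestronglyMeasurable hQm
  · filter_upwards [ae_restrict_mem hQm] with y hy x hx
    exact hC (x, y) ⟨hx, hy⟩
  · filter_upwards [ae_restrict_mem hQm] with y hy x hx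
    exact hd x (hball hx) y hy

end ParametricIntegral

/-! ### Averages of a kernel over displaced particles. -/

section DisplacedAverage

open scoped NNReal Topology BoundedContinuousFunction

/-- The average of a kernel `κ` with respect to the density `f₀` on `Q` after moving the points of
`Q` by `u` in the second coordinate. -/
noncomputable def displacedAverage (Q : Set (ℝ × ℝ)) (κ f₀ u : ℝ × ℝ → ℝ) (q : ℝ × ℝ) : ℝ :=
  ∫ p in Q, κ (q.1 - p.1, q.2 - p.2 - u p) * f₀ p

variable {Q : Set (ℝ × ℝ)} {κ κ' f₀ u v : ℝ × ℝ → ℝ}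

theorem continuous_displacedAverage (hQ : IsCompact Q) (hκ : Continuous κ) (hf₀ : Continuous f₀)
    (hu : Continuous u) : Continuous (displacedAverage Q κ f₀ u) := by
  refine continuous_parametric_integral_of_continuous
    (f := fun (q p : ℝ × ℝ) => κ (q.1 - p.1, q.2 - p.2 - u p) * f₀ p) ?_ hQ
  unfold Function.uncurry
  fun_prop

/-- Asking for the bound only where `f₀ p ≠ 0` is what later gives a speed that depends on the
support of `f₀` and not on the cutoff. -/
theorem abs_displacedAverage_le (hQ : IsCompact Q) (hf₀ : Continuous f₀) {M : ℝ} {q : ℝ × ℝ}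
    (hM : ∀ p ∈ Q, f₀ p ≠ 0 → |κ (q.1 - p.1, q.2 - p.2 - u p)| ≤ M) :
    |displacedAverage Q κ f₀ u q| ≤ M * ∫ p in Q, |f₀ p| := by
  rw [← integral_const_mul, ← Real.norm_eq_abs]
  refine norm_integral_le_of_norm_le
    ((hf₀.abs.continuousOn.integrableOn_compact hQ).const_mul M) ?_
  filter_upwards [ae_restrict_mem hQ.measurableSet] with p hp
  rw [norm_mul, Real.norm_eq_abs, Real.norm_eq_abs]
  by_cases h : f₀ p = 0
  · simp [h]
  · gcongr
    exact hM p hp h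

/-- Varying the point and the displacement together serves twice: for the Lipschitz bound of the ODE
for displacements, and for that of the velocity in `(t, θ, x)`. -/
theorem dist_displacedAverage_le (hQ : IsCompact Q) (hf₀ : Continuous f₀) {K : ℝ≥0}
    (hκ : LipschitzWith K κ) (hu : Continuous u) (hv : Continuous v) {δ : ℝ}
    (hδ : ∀ p, |u p - v p| ≤ δ) (q q' : ℝ × ℝ) :
    dist (displacedAverage Q κ f₀ u q) (displacedAverage Q κ f₀ v q')
      ≤ K * (dist q q' + δ) * ∫ p in Q, |f₀ p| := by
  have hκc := hκ.continuous
  have hint : ∀ {w : ℝ × ℝ → ℝ} (q : ℝ × ℝ), Continuous w →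
      IntegrableOn (fun p => κ (q.1 - p.1, q.2 - p.2 - w p) * f₀ p) Q := fun q hw =>
    (by fun_prop : Continuous fun p => κ (q.1 - p.1, q.2 - p.2 - _) * f₀ p)
      |>.continuousOn.integrableOn_compact hQ
  rw [dist_eq_norm, displacedAverage, displacedAverage, ← integral_sub (hint q hu) (hint q' hv),
    ← integral_const_mul]
  refine norm_integral_le_of_norm_le
    ((hf₀.abs.continuousOn.integrableOn_compact hQ).const_mul _)
    (Filter.Eventually.of_forall fun p => ?_)
  rw [← sub_mul, norm_mul, Real.norm_eq_abs (f₀ p), ← dist_eq_norm]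
  gcongr
  refine (hκ.dist_le_mul _ _).trans ?_
  gcongr
  have h1 : |q.1 - q'.1| ≤ dist q q' := by
    rw [← Real.dist_eq]; exact le_max_left _ _
  have h2 : |q.2 - q'.2| ≤ dist q q' := by
    rw [← Real.dist_eq]; exact le_max_right _ _
  have hδ0 : 0 ≤ δ := (abs_nonneg _).trans (hδ p)
  rw [Prod.dist_eq, Real.dist_eq, Real.dist_eq]
  refine max_le ?_ ?_
  · rw [sub_sub_sub_cancel_right]; linarith
  · have : q.2 - p.2 - u p - (q'.2 - p.2 - v p) = (q.2 - q'.2) - (u p - v p) := by ring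
    rw [this]
    exact (abs_sub _ _).trans (add_le_add h2 (hδ p))

theorem hasDerivAt_displacedAverage (hQ : IsCompact Q) (hκ : Continuous κ) (hκ' : Continuous κ')
    (hd : ∀ η ρ, HasDerivAt (fun ρ => κ (η, ρ)) (κ' (η, ρ)) ρ) (hf₀ : Continuous f₀)
    (hu : Continuous u) (θ x : ℝ) :
    HasDerivAt (fun x => displacedAverage Q κ f₀ u (θ, x)) (displacedAverage Q κ' f₀ u (θ, x))
      x := by
  refine hasDerivAt_setIntegral_of_continuousOn hQ isOpen_univ
    (F := fun x p => κ (θ - p.1, x - p.2 - u p) * f₀ p)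
    (F' := fun x p => κ' (θ - p.1, x - p.2 - u p) * f₀ p) ?_ ?_ (fun x _ p _ => ?_) (mem_univ x)
  · unfold Function.uncurry
    exact Continuous.continuousOn (by fun_prop)
  · unfold Function.uncurry
    exact Continuous.continuousOn (by fun_prop)
  · refine HasDerivAt.mul_const ?_ _
    have := (hd (θ - p.1) (x - p.2 - u p)).comp x (((hasDerivAt_id x).sub_const p.2).sub_const (u p))
    simpa using! this

theorem contDiff_displacedAverage (hQ : IsCompact Q) (hκ : ContDiff ℝ 1 κ) (hf₀ : Continuous f₀)
    {u u' : ℝ → ℝ × ℝ → ℝ} (hu : Continuous u.uncurry) (hu' : Continuous u'.uncurry)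
    (hd : ∀ t p, HasDerivAt (fun t => u t p) (u' t p) t) :
    ContDiff ℝ 1 fun z : ℝ × ℝ × ℝ => displacedAverage Q κ f₀ (u z.1) z.2 := by
  -- The argument of `κ` has differential `L₀ - u' • L₁`: `L₀` is that of `(θ, x)`, and `L₁` puts
  -- `dt` in the second slot.
  set L₀ : ℝ × ℝ × ℝ →L[ℝ] ℝ × ℝ := ContinuousLinearMap.snd ℝ ℝ (ℝ × ℝ)
  set L₁ : ℝ × ℝ × ℝ →L[ℝ] ℝ × ℝ :=
    (0 : ℝ × ℝ × ℝ →L[ℝ] ℝ).prod (ContinuousLinearMap.fst ℝ ℝ (ℝ × ℝ))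
  have hu2 : Continuous fun w : (ℝ × ℝ × ℝ) × (ℝ × ℝ) => u w.1.1 w.2 :=
    hu.comp (by fun_prop : Continuous fun w : (ℝ × ℝ × ℝ) × (ℝ × ℝ) => (w.1.1, w.2))
  have hu2' : Continuous fun w : (ℝ × ℝ × ℝ) × (ℝ × ℝ) => u' w.1.1 w.2 :=
    hu'.comp (by fun_prop : Continuous fun w : (ℝ × ℝ × ℝ) × (ℝ × ℝ) => (w.1.1, w.2))
  have hκc := hκ.continuous
  have hκd := hκ.continuous_fderiv one_ne_zero
  have hinner : Continuous fun w : (ℝ × ℝ × ℝ) × (ℝ × ℝ) =>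
      ((w.1.2.1 - w.2.1, w.1.2.2 - w.2.2 - u w.1.1 w.2) : ℝ × ℝ) := by fun_prop
  refine contDiff_one_setIntegral hQ
    (F := fun (z : ℝ × ℝ × ℝ) p => κ (z.2.1 - p.1, z.2.2 - p.2 - u z.1 p) * f₀ p)
    (F' := fun z p => f₀ p • (fderiv ℝ κ (z.2.1 - p.1, z.2.2 - p.2 - u z.1 p)).comp
      (L₀ - u' z.1 p • L₁)) ?_ ?_ (fun z p => ?_)
  · exact (hκc.comp hinner).mul (hf₀.comp continuous_snd)
  · exact (hf₀.comp continuous_snd).smul ((hκd.comp hinner).clm_comp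
      (continuous_const.sub (hu2'.smul continuous_const)))
  · refine HasFDerivAt.mul_const ?_ _
    · refine HasFDerivAt.comp z (hκ.differentiable one_ne_zero _).hasFDerivAt ?_
      have h1 : HasFDerivAt (fun z : ℝ × ℝ × ℝ => u z.1 p)
          (u' z.1 p • ContinuousLinearMap.fst ℝ ℝ (ℝ × ℝ)) z := by
        exact (hd z.1 p).comp_hasFDerivAt z hasFDerivAt_fst
      have h2 := ((hasFDerivAt_fst (𝕜 := ℝ) (p := z.2)).comp z
        (hasFDerivAt_snd (𝕜 := ℝ) (p := z))).sub_const p.1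
      have h3 := (((hasFDerivAt_snd (𝕜 := ℝ) (p := z.2)).comp z
        (hasFDerivAt_snd (𝕜 := ℝ) (p := z))).sub_const p.2).sub h1
      refine (h2.prodMk h3).congr_fderiv ?_
      ext <;> simp [L₀, L₁]

end DisplacedAverage

/-! ### The particle system as an ODE in a space of bounded functions. -/

section Displacement

open scoped NNReal Topology BoundedContinuousFunction

variable {Q : Set (ℝ × ℝ)} {κ f₀ : ℝ × ℝ → ℝ}

/-- The particles starting at the points of the plane, moving in the second coordinate with the
velocity generated by all of them, have globally defined displacements `u`. -/
theorem exists_displacement (hQ : IsCompact Q) (hf₀ : Continuous f₀) {K : ℝ≥0}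
    (hκ : LipschitzWith K κ) {C : ℝ} (hC : ∀ z, |κ z| ≤ C) :
    ∃ u : ℝ → ℝ × ℝ → ℝ, (∀ p, u 0 p = 0) ∧ Continuous u.uncurry ∧
      (∀ t p, HasDerivAt (fun t => u t p)
        (displacedAverage Q κ f₀ (u t) (p.1, p.2 + u t p)) t) ∧
      Continuous (fun t p => displacedAverage Q κ f₀ (u t) (p.1, p.2 + u t p)).uncurry := by
  set I := ∫ p in Q, |f₀ p| with hI
  have hI0 : 0 ≤ I := integral_nonneg fun _ => abs_nonneg _
  -- The unknown is the displacement and not the position, which is unbounded.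
  set N : (ℝ × ℝ →ᵇ ℝ) → (ℝ × ℝ →ᵇ ℝ) := fun U =>
    BoundedContinuousFunction.ofNormedAddCommGroup
      (fun p => displacedAverage Q κ f₀ U (p.1, p.2 + U p))
      ((continuous_displacedAverage hQ hκ.continuous hf₀ U.continuous).comp (by fun_prop))
      (C * I) (fun p => abs_displacedAverage_le hQ hf₀ fun _ _ _ => hC _) with hN
  -- The factor 2 appears because `U` moves both the observed particle and the particles acting on
  -- it.
  have hNlip : LipschitzWith (K * 2 * ⟨I, hI0⟩) N := by
    refine LipschitzWith.of_dist_le_mul fun U W => ?_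
    rw [BoundedContinuousFunction.dist_le (by positivity)]
    intro p
    have hUW : ∀ p, |U p - W p| ≤ dist U W := fun p => by
      rw [← Real.dist_eq]; exact BoundedContinuousFunction.dist_coe_le_dist p
    refine (dist_displacedAverage_le hQ hf₀ hκ U.continuous W.continuous hUW _ _).trans ?_
    have h1 : dist ((p.1, p.2 + U p) : ℝ × ℝ) (p.1, p.2 + W p) ≤ dist U W := by
      rw [Prod.dist_eq]
      refine max_le (by simp) ?_
      rw [dist_add_left]
      exact BoundedContinuousFunction.dist_coe_le_dist p
    have e : ((K * 2 * ⟨I, hI0⟩ : ℝ≥0) : ℝ) * dist U W = K * (dist U W + dist U W) * I := by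
      change (K : ℝ) * 2 * I * _ = _
      ring
    rw [e]
    gcongr
  obtain ⟨U, hU0, hU⟩ := exists_hasDerivAt_of_lipschitz (v := fun _ => N) (fun _ => hNlip)
    (fun _ => continuous_const) 0
  have hUc : Continuous U := continuous_iff_continuousAt.2 fun t => (hU t).continuousAt
  refine ⟨fun t p => U t p, fun p => by simp [hU0], ?_, fun t p => ?_, ?_⟩
  · exact (hUc.comp continuous_fst).eval continuous_snd
  · exact (BoundedContinuousFunction.evalCLM ℝ p).hasFDerivAt.comp_hasDerivAt t (hU t)
  · exact ((hNlip.continuous.comp hUc).comp continuous_fst).eval continuous_snd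

end Displacement

/-! ### Global solutions for compactly supported kernels. -/

section CompactKernel

open scoped NNReal Topology

theorem integrable_of_continuous_of_bounded_support {g : ℝ × ℝ → ℝ} (hg : Continuous g) {ρ : ℝ}
    (hs : ∀ p, g p ≠ 0 → |p.1| ≤ ρ ∧ |p.2| ≤ ρ) : Integrable g := by
  refine hg.integrable_of_hasCompactSupport (HasCompactSupport.intro
    ((isCompact_Icc (a := -ρ) (b := ρ)).prod (isCompact_Icc (a := -ρ) (b := ρ))) fun p hp => ?_)
  by_contra h
  exact hp ⟨abs_le.1 (hs p h).1, abs_le.1 (hs p h).2⟩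

theorem abs_sub_le_of_hasDerivAt {y y' : ℝ → ℝ} {C : ℝ} (hy : ∀ t, HasDerivAt y (y' t) t)
    (hC : ∀ t, |y' t| ≤ C) (t s : ℝ) : |y t - y s| ≤ C * |t - s| :=
  convex_univ.norm_image_sub_le_of_norm_hasDerivWithin_le
    (fun t _ => (hy t).hasDerivWithinAt) (fun t _ => hC t) (mem_univ s) (mem_univ t)

/-- The change of variables given by a family of diffeomorphisms of the line. -/
theorem integral_mul_eq_of_fibrewise {Ψ g₀ g e X : ℝ × ℝ → ℝ}
    (hbij : ∀ θ, Function.Bijective fun r => X (θ, r))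
    (hX : ∀ θ r, HasDerivAt (fun r => X (θ, r)) (e (θ, r)) r) (he : ∀ p, 0 < e p)
    (hg : ∀ θ r, g (θ, X (θ, r)) * e (θ, r) = g₀ (θ, r))
    (hi : Integrable fun p => Ψ p * g p) (hi₀ : Integrable fun p => Ψ (p.1, X p) * g₀ p) :
    ∫ p, Ψ p * g p = ∫ p, Ψ (p.1, X p) * g₀ p := by
  rw [Measure.volume_eq_prod] at hi hi₀ ⊢
  rw [integral_prod _ hi, integral_prod _ hi₀]
  congr 1
  ext θ
  have := integral_image_eq_integral_abs_deriv_smul (f := fun r => X (θ, r))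
    (f' := fun r => e (θ, r)) MeasurableSet.univ (fun r _ => (hX θ r).hasDerivWithinAt)
    (hbij θ).1.injOn (fun x => Ψ (θ, x) * g (θ, x))
  rw [image_univ, (hbij θ).2.range_eq, setIntegral_univ, setIntegral_univ] at this
  rw [this]
  congr 1
  ext r
  rw [abs_of_pos (he _), smul_eq_mul, ← hg]
  ring

/-- The nonlocal transport equation with a compactly supported kernel has a global solution. -/
theorem exists_solution_of_hasCompactSupport_kernel {κ κ' f₀ : ℝ × ℝ → ℝ}
    (hκ : ContDiff ℝ 1 κ) (hκs : HasCompactSupport κ) (hκ' : ContDiff ℝ 1 κ')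
    (hκs' : HasCompactSupport κ')
    (hd : ∀ η ρ, HasDerivAt (fun ρ => κ (η, ρ)) (κ' (η, ρ)) ρ)
    (hf₀ : ContDiff ℝ 1 f₀) (hs : HasCompactSupport f₀) {R M : ℝ}
    (hR : ∀ p, f₀ p ≠ 0 → |p.1| ≤ R ∧ |p.2| ≤ R)
    (hM : ∀ θ θ' ρ, |θ| ≤ R → |θ'| ≤ R → |κ (θ - θ', ρ)| ≤ M) :
    ∃ f : ℝ → ℝ → ℝ → ℝ, ContDiff ℝ 1 (fun p : ℝ × ℝ × ℝ => f p.1 p.2.1 p.2.2) ∧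
      (∀ θ x, f 0 θ x = f₀ (θ, x)) ∧
      (∀ t θ x, f t θ x ≠ 0 → |θ| ≤ R ∧ |x| ≤ R + M * (∫ p, |f₀ p|) * |t|) ∧
      ∀ t θ x, ∃ d,
        HasDerivAt (fun y => ∫ p : ℝ × ℝ, κ (θ - p.1, y - p.2) * f t p.1 p.2) d x ∧
        deriv (fun s => f s θ x) t
          + ((∫ p : ℝ × ℝ, κ (θ - p.1, x - p.2) * f t p.1 p.2) * deriv (fun y => f t θ y) x
            + d * f t θ x) = 0 := by
  set Q := tsupport f₀
  have hQ : IsCompact Q := hs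
  have hQ0 : ∀ p, p ∉ Q → f₀ p = 0 := fun p hp => image_eq_zero_of_notMem_tsupport hp
  have hf₀c := hf₀.continuous
  obtain ⟨K, hK⟩ : ∃ K, LipschitzWith K κ := 
    ContDiff.lipschitzWith_of_hasCompactSupport hκs hκ (by simp)
  obtain ⟨K', hK'⟩ : ∃ K, LipschitzWith K κ' :=
    ContDiff.lipschitzWith_of_hasCompactSupport hκs' hκ' (by simp)
  obtain ⟨C, hC⟩ := hκs.exists_bound_of_continuous hκ.continuous
  obtain ⟨u, hu0, huc, hu, hucd⟩ := exists_displacement hQ hf₀c hK hC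
  have hI : ∫ p in Q, |f₀ p| = ∫ p, |f₀ p| :=
    setIntegral_eq_integral_of_forall_compl_eq_zero fun p hp => by simp [hQ0 p hp]
  set I := ∫ p, |f₀ p|
  have hI0 : 0 ≤ I := integral_nonneg fun _ => abs_nonneg _
  have hC0 : 0 ≤ C := (norm_nonneg _).trans (hC 0)
  have hut : ∀ t, Continuous (u t) := fun t => huc.comp (Continuous.prodMk_right t)
  have hulip : ∀ t s p, |u t p - u s p| ≤ C * I * |t - s| := fun t s p =>
    abs_sub_le_of_hasDerivAt (fun t => hu t p) (fun t => by
      rw [← hI]; exact abs_displacedAverage_le hQ hf₀c fun _ _ _ => hC _) t s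
  have hlip : ∀ {κ : ℝ × ℝ → ℝ} {K : ℝ≥0}, LipschitzWith K κ →
      LipschitzWith (K * (1 + ⟨C * I, by positivity⟩) * ⟨I, hI0⟩)
        fun z : ℝ × ℝ × ℝ => displacedAverage Q κ f₀ (u z.1) z.2 := fun {κ K} hK => by
    refine LipschitzWith.of_dist_le_mul fun z z' => ?_
    refine (dist_displacedAverage_le hQ hf₀c hK (hut _) (hut _) (hulip z.1 z'.1) _ _).trans ?_
    rw [hI]
    have h1 : |z.1 - z'.1| ≤ dist z z' := by rw [← Real.dist_eq]; exact le_max_left _ _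
    have h2 : dist z.2 z'.2 ≤ dist z z' := le_max_right _ _
    calc _ ≤ K * (dist z z' + C * I * dist z z') * I := by gcongr
      _ = _ := by
        change _ = (K : ℝ) * (1 + C * I) * I * _
        ring
  set a : ℝ × ℝ × ℝ → ℝ := fun z => displacedAverage Q κ f₀ (u z.1) z.2 with ha
  set c : ℝ × ℝ × ℝ → ℝ := fun z => displacedAverage Q κ' f₀ (u z.1) z.2 with hc
  have haL : LipschitzWith _ a := hlip hK
  have hcL : LipschitzWith _ c := hlip hK'
  have ha1 : ContDiff ℝ 1 a := contDiff_displacedAverage hQ hκ hf₀c huc hucd hu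
  have hc1 : ContDiff ℝ 1 c := contDiff_displacedAverage hQ hκ' hf₀c huc hucd hu
  have hac : ∀ t θ x, HasDerivAt (fun y => a (t, θ, y)) (c (t, θ, x)) x := fun t θ x =>
    hasDerivAt_displacedAverage hQ hκ.continuous hκ'.continuous hd hf₀c (hut t) θ x
  obtain ⟨KV, hV⟩ := exists_lipschitzWith_characteristicField haL hcL
  have hV1 := contDiff_characteristicField ha1 hc1
  obtain ⟨φ, hφ⟩ := exists_isGlobalFlow hV
  have hf := contDiff_transportSolution hf₀ (hφ.contDiff hV hV1)
  set f := transportSolution φ f₀ with hfdef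
  -- Particles and characteristics solve the same scalar Lipschitz ODE with the same initial value.
  have hX : ∀ t θ r, (φ t (0, θ, r, 0)).2.2.1 = r + u t (θ, r) := fun t θ r => by
    refine eq_of_hasDerivAt_of_lipschitz (v := fun t y => a (t, θ, y)) (T := |t| + 1)
      (f := fun t => (φ t (0, θ, r, 0)).2.2.1) (g := fun t => r + u t (θ, r))
      (fun t => haL.comp (g := fun y => (t, θ, y)) (Kg := 1)
        (LipschitzWith.of_dist_le_mul fun x y => by simp [Prod.dist_eq]))
      (fun s _ => hasDerivAt_time_characteristic hφ s θ r)
      (fun s _ => (hu s (θ, r)).const_add r) (by simp [hφ.zero, hu0]) (lt_add_one _)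
  have hpush : ∀ t θ r, f t θ (r + u t (θ, r)) * Real.exp (φ t (0, θ, r, 0)).2.2.2
      = f₀ (θ, r) := fun t θ r => by
    have := transportSolution_add hφ hV f₀ t 0 θ r
    rw [zero_add, hX, transportSolution_zero hφ, ← hfdef] at this
    rw [this, mul_assoc, ← Real.exp_add]
    simp
  have hbij : ∀ t θ, Function.Bijective fun r => r + u t (θ, r) := fun t θ => by
    simpa only [hX] using bijective_characteristic hφ hV t θ
  have hXd : ∀ t θ r, HasDerivAt (fun r => r + u t (θ, r))
      (Real.exp (φ t (0, θ, r, 0)).2.2.2) r := fun t θ r => by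
    simpa only [hX] using hasDerivAt_characteristic hφ hV hV1 ha1 hac t θ r
  have hsupp : ∀ t θ x, f t θ x ≠ 0 → |θ| ≤ R ∧ |x| ≤ R + M * I * |t| := fun t θ x h => by
    obtain ⟨r, rfl⟩ := (hbij t θ).2 x
    have h0 : f₀ (θ, r) ≠ 0 := by
      rw [← hpush t]
      exact mul_ne_zero h (Real.exp_pos _).ne'
    obtain ⟨h1, h2⟩ := hR _ h0
    refine ⟨h1, (abs_add_le _ _).trans (add_le_add h2 ?_)⟩
    -- Both `θ` and the `θ'` of the acting particles lie in the support of `f₀`, so the speed is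
    -- governed by `M` and not by the global bound `C`.
    have := abs_sub_le_of_hasDerivAt (fun t => hu t (θ, r)) (C := M * I) (fun t => by
      rw [← hI]
      exact abs_displacedAverage_le hQ hf₀c fun p _ hp => hM _ _ _ h1 (hR p hp).1) t 0
    simpa [hu0] using this
  have hft : ∀ t, Continuous fun p : ℝ × ℝ => f t p.1 p.2 := fun t =>
    hf.continuous.comp (Continuous.prodMk_right t)
  -- This closes the nonlocal loop: pushing `f₀` forward along the particles turns the Lagrangian
  -- average into the integral against `f t`.
  have hA : ∀ t θ x, ∫ p : ℝ × ℝ, κ (θ - p.1, x - p.2) * f t p.1 p.2 = a (t, θ, x) := by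
    intro t θ x
    have hκc := hκ.continuous
    have hutc := hut t
    have hftc := hft t
    have h1 : Integrable fun p : ℝ × ℝ => κ (θ - p.1, x - p.2) * f t p.1 p.2 :=
      integrable_of_continuous_of_bounded_support (ρ := max R (R + M * I * |t|)) (by fun_prop)
        fun p hp => (hsupp t _ _ (right_ne_zero_of_mul hp)).imp
          (fun h => h.trans (le_max_left _ _)) fun h => h.trans (le_max_right _ _)
    have h2 : Integrable fun p : ℝ × ℝ => κ (θ - p.1, x - (p.2 + u t p)) * f₀ p :=
      integrable_of_continuous_of_bounded_support (ρ := R) (by fun_prop)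
        fun p hp => hR p (right_ne_zero_of_mul hp)
    rw [integral_mul_eq_of_fibrewise (Ψ := fun p => κ (θ - p.1, x - p.2))
      (g := fun p => f t p.1 p.2) (X := fun p => p.2 + u t p) (g₀ := f₀)
      (e := fun p => Real.exp (φ t (0, p.1, p.2, 0)).2.2.2) (hbij t) (hXd t)
      (fun p => Real.exp_pos _) (hpush t) h1 h2, ha]
    simp only [displacedAverage]
    rw [setIntegral_eq_integral_of_forall_compl_eq_zero fun p hp => by simp [hQ0 p hp]]
    simp only [sub_sub]
  refine ⟨f, hf, transportSolution_zero hφ f₀, hsupp, fun t θ x => ⟨c (t, θ, x), ?_, ?_⟩⟩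
  · simpa only [hA] using hac t θ x
  · rw [hA]
    exact transportSolution_equation hφ hV hf t θ x

end CompactKernel

/-! ### The interaction kernel, its cutoff, and existence. -/

section Kernel

open scoped NNReal Topology ContDiff

/-- The kernel of the integral operator `velocity`. -/
noncomputable def interactionKernel (w b : ℝ → ℝ) (σ : ℝ) (p : ℝ × ℝ) : ℝ :=
  w p.2 * (b p.1 + σ ^ 2 * iteratedDeriv 2 b p.1 - b p.2)

theorem velocityIntegrand_eq (w b : ℝ → ℝ) (σ : ℝ) (g : ℝ → ℝ → ℝ) (θ r : ℝ) (p : ℝ × ℝ) :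
    velocityIntegrand w b σ g θ r p
      = interactionKernel w b σ (θ - p.1, r - p.2) * g p.1 p.2 := rfl

variable {w b : ℝ → ℝ}

theorem IsOutcomeFunction.contDiff_add_iteratedDeriv (hb : IsOutcomeFunction b) (σ : ℝ) :
    ContDiff ℝ 1 fun η => b η + σ ^ 2 * iteratedDeriv 2 b η := by
  have h1 : ContDiff ℝ 1 b := hb.contDiff.of_le (by norm_num)
  have h2 : ContDiff ℝ 1 (iteratedDeriv 2 b) := by
    rw [iteratedDeriv_eq_iterate]
    exact ContDiff.iterate_deriv' 1 2 (hb.contDiff.of_le (by norm_num))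
  exact h1.add (contDiff_const.mul h2)

theorem contDiff_interactionKernel (hb : IsOutcomeFunction b) (hw : IsInteractionRate w) (σ : ℝ) :
    ContDiff ℝ 1 (interactionKernel w b σ) := by
  have h1 : ContDiff ℝ 1 b := hb.contDiff.of_le (by norm_num)
  have h2 : ContDiff ℝ 1 w := hw.contDiff.of_le (by norm_num)
  exact (h2.comp contDiff_snd).mul
    (((hb.contDiff_add_iteratedDeriv σ).comp contDiff_fst).sub (h1.comp contDiff_snd))

/-- Only `b''` may be unbounded, and it sees `η` alone; boundedness of `w` and `b` makes the
estimate uniform in `ρ`. -/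
theorem exists_abs_interactionKernel_le (hb : IsOutcomeFunction b) (hw : IsInteractionRate w)
    (σ R : ℝ) : ∃ M, 0 ≤ M ∧ ∀ η ρ, |η| ≤ R → |interactionKernel w b σ (η, ρ)| ≤ M := by
  obtain ⟨Cw, hCw⟩ := hw.bounded
  obtain ⟨Cb, hCb⟩ := hb.bounded
  obtain ⟨C, hC⟩ := (isCompact_Icc (a := -R) (b := R)).exists_bound_of_continuousOn
    (hb.contDiff_add_iteratedDeriv σ).continuous.continuousOn
  have hCw0 : 0 ≤ Cw := (hw.nonneg 0).trans (hCw 0)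
  have hCb0 : 0 ≤ Cb := (abs_nonneg _).trans (hCb 0)
  refine ⟨Cw * (|C| + Cb), by positivity, fun η ρ hη => ?_⟩
  rw [interactionKernel, abs_mul, abs_of_nonneg (hw.nonneg ρ)]
  refine mul_le_mul (hCw ρ) ?_ (abs_nonneg _) hCw0
  exact (abs_sub _ _).trans
    (add_le_add ((hC η (abs_le.1 hη)).trans (le_abs_self C)) (hCb ρ))

/-- The interaction kernel may be cut off outside a large square without destroying its
regularity. -/
theorem exists_cutoff_interactionKernel (hb : IsOutcomeFunction b) (hw : IsInteractionRate w)
    (σ : ℝ) {R : ℝ} (hR : 0 < R) :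
    ∃ κ κ' : ℝ × ℝ → ℝ, ContDiff ℝ 1 κ ∧ HasCompactSupport κ ∧ ContDiff ℝ 1 κ' ∧
      HasCompactSupport κ' ∧ (∀ η ρ, HasDerivAt (fun ρ => κ (η, ρ)) (κ' (η, ρ)) ρ) ∧
      (∀ η ρ, |η| ≤ R → |ρ| ≤ R → κ (η, ρ) = interactionKernel w b σ (η, ρ)) ∧
      ∀ p, |κ p| ≤ |interactionKernel w b σ p| := by
  set χ : ContDiffBump (0 : ℝ) := ⟨R, R + 1, hR, by linarith⟩ with hχ
  have hχ1 : ∀ x, |x| ≤ R → χ x = 1 := fun x hx =>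
    χ.one_of_mem_closedBall (by simpa [hχ] using hx)
  have hχs : HasCompactSupport χ := χ.hasCompactSupport
  have hχc : ∀ n : ℕ, ContDiff ℝ n χ := fun n => χ.contDiff
  set B : ℝ → ℝ := fun η => b η + σ ^ 2 * iteratedDeriv 2 b η with hB
  have hBc : ContDiff ℝ 1 B := hb.contDiff_add_iteratedDeriv σ
  -- Separating variables as `χ η * (g₁ ρ * B η - g₂ ρ)` lets the `ρ`-derivative fall on `C^2`
  -- functions only. Thus it is again `C^1`, although `B` is merely `C^1`.
  set g₁ : ℝ → ℝ := fun ρ => χ ρ * w ρ with hg₁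
  set g₂ : ℝ → ℝ := fun ρ => χ ρ * (w ρ * b ρ) with hg₂
  have hg₁c : ContDiff ℝ 2 g₁ := (hχc 2).mul hw.contDiff
  have hg₂c : ContDiff ℝ 2 g₂ :=
    (hχc 2).mul (hw.contDiff.mul (hb.contDiff.of_le (by norm_num)))
  have hd₁ : ContDiff ℝ 1 (deriv g₁) := ContDiff.iterate_deriv' 1 1 hg₁c
  have hd₂ : ContDiff ℝ 1 (deriv g₂) := ContDiff.iterate_deriv' 1 1 hg₂c
  have hz₁ : ∀ ρ, ρ ∉ tsupport χ → deriv g₁ ρ = 0 := fun ρ hρ =>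
    image_eq_zero_of_notMem_tsupport fun h =>
      hρ (tsupport_mul_subset_left (tsupport_deriv_subset h))
  have hz₂ : ∀ ρ, ρ ∉ tsupport χ → deriv g₂ ρ = 0 := fun ρ hρ =>
    image_eq_zero_of_notMem_tsupport fun h =>
      hρ (tsupport_mul_subset_left (tsupport_deriv_subset h))
  have hz : ∀ ρ, ρ ∉ tsupport χ → χ ρ = 0 := fun ρ hρ => image_eq_zero_of_notMem_tsupport hρ
  have hχ' : ContDiff ℝ 1 χ := hχc 1
  refine ⟨fun p => χ p.1 * (g₁ p.2 * B p.1 - g₂ p.2),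
    fun p => χ p.1 * (deriv g₁ p.2 * B p.1 - deriv g₂ p.2), ?_, ?_, ?_, ?_, ?_, ?_, ?_⟩
  · exact (hχ'.comp contDiff_fst).mul ((((hg₁c.of_le (by norm_num)).comp contDiff_snd).mul
      (hBc.comp contDiff_fst)).sub ((hg₂c.of_le (by norm_num)).comp contDiff_snd))
  · refine HasCompactSupport.intro (hχs.isCompact.prod hχs.isCompact) fun p hp => ?_
    rw [mem_prod, not_and_or] at hp
    rcases hp with h | h <;> simp [hg₁, hg₂, hz _ h]
  · exact (hχ'.comp contDiff_fst).mul (((hd₁.comp contDiff_snd).mul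
      (hBc.comp contDiff_fst)).sub (hd₂.comp contDiff_snd))
  · refine HasCompactSupport.intro (hχs.isCompact.prod hχs.isCompact) fun p hp => ?_
    rw [mem_prod, not_and_or] at hp
    rcases hp with h | h
    · simp [hz _ h]
    · simp [hz₁ _ h, hz₂ _ h]
  · intro η ρ
    exact ((((hg₁c.differentiable two_ne_zero ρ).hasDerivAt).mul_const (B η)).sub
      (hg₂c.differentiable two_ne_zero ρ).hasDerivAt).const_mul (χ η)
  · intro η ρ hη hρ
    simp only [hg₁, hg₂, hχ1 η hη, hχ1 ρ hρ, interactionKernel, hB]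
    ring
  · intro p
    have e : χ p.1 * (g₁ p.2 * B p.1 - g₂ p.2)
        = χ p.1 * χ p.2 * interactionKernel w b σ p := by
      simp only [hg₁, hg₂, interactionKernel, hB]
      ring
    change |χ p.1 * (g₁ p.2 * B p.1 - g₂ p.2)| ≤ _
    rw [e, abs_mul]
    refine mul_le_of_le_one_left (abs_nonneg _) ?_
    rw [abs_of_nonneg (mul_nonneg χ.nonneg χ.nonneg)]
    exact mul_le_one₀ χ.le_one χ.nonneg χ.le_one

theorem exists_abs_le_of_hasCompactSupport {f₀ : ℝ → ℝ → ℝ}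
    (hsupp : HasCompactSupport (fun p : ℝ × ℝ => f₀ p.1 p.2)) :
    ∃ R, 0 ≤ R ∧ ∀ p : ℝ × ℝ, f₀ p.1 p.2 ≠ 0 → |p.1| ≤ R ∧ |p.2| ≤ R := by
  obtain ⟨R, hR⟩ := hsupp.isCompact.isBounded.exists_norm_le
  refine ⟨|R|, abs_nonneg R, fun p hp => ?_⟩
  have := (hR p (subset_tsupport _ hp)).trans (le_abs_self R)
  exact ⟨(norm_fst_le p).trans this, (norm_snd_le p).trans this⟩

theorem exists_isClassicalSolution (hb : IsOutcomeFunction b) (hw : IsInteractionRate w) (σ : ℝ)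
    {f₀ : ℝ → ℝ → ℝ} (hf₀ : ContDiff ℝ 1 (fun p : ℝ × ℝ => f₀ p.1 p.2))
    (hsupp : HasCompactSupport (fun p : ℝ × ℝ => f₀ p.1 p.2)) {T : ℝ} (hT : 0 < T) :
    ∃ f : ℝ → ℝ → ℝ → ℝ, IsClassicalSolution w b σ f₀ T f := by
  obtain ⟨R, hR0, hR⟩ := exists_abs_le_of_hasCompactSupport hsupp
  obtain ⟨M, hM0, hM⟩ := exists_abs_interactionKernel_le hb hw σ (2 * R)
  set I := ∫ p : ℝ × ℝ, |f₀ p.1 p.2| with hI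
  have hI0 : 0 ≤ I := integral_nonneg fun _ => abs_nonneg _
  -- `S` bounds the positions reached before time `T`. As `M` was fixed before the cutoff, the
  -- cutoff radius may depend on `S`.
  set S := R + M * I * T with hS
  have hS0 : 0 ≤ S := by positivity
  obtain ⟨κ, κ', hκ, hκs, hκ', hκs', hd, hκeq, hκle⟩ :=
    exists_cutoff_interactionKernel hb hw σ (R := 2 * S + 2 + 2 * R) (by positivity)
  obtain ⟨f, hf, hf0, hfs, hfeq⟩ := exists_solution_of_hasCompactSupport_kernel hκ hκs hκ' hκs' hd
    hf₀ hsupp hR (M := M) fun θ θ' ρ h h' => (hκle _).trans (hM _ _ (by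
      refine (abs_sub _ _).trans ?_; linarith))
  have hft : ∀ t, Continuous fun p : ℝ × ℝ => f t p.1 p.2 := fun t =>
    hf.continuous.comp (Continuous.prodMk_right t)
  have hk : Continuous (interactionKernel w b σ) := (contDiff_interactionKernel hb hw σ).continuous
  have hfS : ∀ t ∈ Ico 0 T, ∀ θ x, f t θ x ≠ 0 → |θ| ≤ R ∧ |x| ≤ S := fun t ht θ x h => by
    obtain ⟨h1, h2⟩ := hfs t θ x h
    refine ⟨h1, h2.trans ?_⟩
    rw [abs_of_nonneg ht.1, hS]
    gcongr
    exact ht.2.le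
  set ρ := max R S with hρ
  have hfρ : ∀ t ∈ Ico 0 T, ∀ θ x, f t θ x ≠ 0 → |θ| ≤ ρ ∧ |x| ≤ ρ := fun t ht θ x h =>
    (hfS t ht θ x h).imp (fun h => h.trans (le_max_left _ _)) fun h => h.trans (le_max_right _ _)
  have hflux : ∀ t ∈ Ico 0 T, ∀ θ r, HasDerivAt (fun r => velocity w b σ (f t) θ r * f t θ r)
      (-deriv (fun s => f s θ r) t) r := by
    intro t ht θ r
    obtain ⟨d, hd, heq⟩ := hfeq t θ r
    -- Near such a point all arguments of the kernel that meet the support of `f t` lie below the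
    -- cutoff radius, so the true and truncated velocities agree. Elsewhere `f t θ` vanishes near
    -- `r` and both fluxes are zero, whatever the velocities.
    by_cases h : |θ| ≤ R ∧ |r| < S + 1
    · have hfx : HasDerivAt (fun y => f t θ y) (deriv (fun y => f t θ y) r) r := by
        have : Differentiable ℝ fun y => f t θ y :=
          (hf.comp (contDiff_const.prodMk (contDiff_const.prodMk contDiff_id))
            : ContDiff ℝ 1 fun y => f t θ y).differentiable one_ne_zero
        exact (this r).hasDerivAt
      have h1 := hd.mul hfx
      have h2 : -deriv (fun s => f s θ r) t = d * f t θ r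
          + (∫ p : ℝ × ℝ, κ (θ - p.1, r - p.2) * f t p.1 p.2) * deriv (fun y => f t θ y) r := by
        linarith
      rw [h2]
      refine h1.congr_of_eventuallyEq ?_
      filter_upwards [(isOpen_lt continuous_abs continuous_const).mem_nhds h.2] with y hy
      have : velocity w b σ (f t) θ y = ∫ p : ℝ × ℝ, κ (θ - p.1, y - p.2) * f t p.1 p.2 := by
        refine integral_congr_ae (Filter.Eventually.of_forall fun p => ?_)
        simp only [velocityIntegrand_eq]
        by_cases h0 : f t p.1 p.2 = 0
        · simp [h0]
        obtain ⟨h3, h4⟩ := hfS t ht _ _ h0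
        replace hy : |y| < S + 1 := hy
        rw [hκeq _ _ ((abs_sub _ _).trans (by linarith [h.1])) ((abs_sub _ _).trans (by linarith))]
      simp only [Pi.mul_apply, this]
    · have h0 : ∀ᶠ y in 𝓝 r, f t θ y = 0 := by
        rw [not_and_or, not_le, not_lt] at h
        rcases h with h | h
        · refine Filter.Eventually.of_forall fun y => ?_
          by_contra h0
          exact absurd (hfS t ht _ _ h0).1 (not_le.2 h)
        · filter_upwards [(isOpen_lt continuous_const continuous_abs).mem_nhds
            (show S < |r| by linarith)] with y hy
          by_contra h0
          exact absurd (hfS t ht _ _ h0).2 (not_le.2 hy)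
      have h1 : deriv (fun y => f t θ y) r = 0 := by
        rw [Filter.EventuallyEq.deriv_eq (f := fun _ => (0 : ℝ)) h0, deriv_const]
      rw [h1, h0.self_of_nhds, mul_zero, mul_zero, add_zero, add_zero] at heq
      rw [heq, neg_zero]
      refine (hasDerivAt_const r (0 : ℝ)).congr_of_eventuallyEq ?_
      filter_upwards [h0] with y hy
      rw [hy, mul_zero]
  refine ⟨f, ⟨hf.contDiffOn, fun t ht θ r => ?_, fun τ hτ R' => ?_, fun t ht θ r =>
    (hflux t ht θ r).differentiableAt, fun t ht θ r => ?_, hf0⟩⟩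
  · have hftc := hft t
    refine integrable_of_continuous_of_bounded_support (ρ := ρ) ?_
      fun p hp => hfρ t ht _ _ (right_ne_zero_of_mul hp)
    simp only [funext (velocityIntegrand_eq w b σ (f t) θ r)]
    fun_prop
  · obtain ⟨M', hM'0, hM'⟩ := exists_abs_interactionKernel_le hb hw σ (R' + R)
    set Q : Set (ℝ × ℝ) := Icc (-ρ) ρ ×ˢ Icc (-ρ) ρ with hQ
    have hQc : IsCompact Q := isCompact_Icc.prod isCompact_Icc
    obtain ⟨C, hC⟩ := ((isCompact_Icc (a := 0) (b := τ)).prod hQc).exists_bound_of_continuousOn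
      hf.continuous.continuousOn
    refine ⟨M' * |C| * volume.real Q, fun t ht θ hθ r => ?_⟩
    have htT : t ∈ Ico 0 T := ⟨ht.1, ht.2.trans_lt hτ⟩
    rw [velocity, ← setIntegral_eq_integral_of_forall_compl_eq_zero (s := Q), ← Real.norm_eq_abs]
    · refine norm_setIntegral_le_of_norm_le_const hQc.measure_lt_top fun p hp => ?_
      rw [velocityIntegrand_eq, norm_mul]
      by_cases h0 : f t p.1 p.2 = 0
      · rw [h0, norm_zero, mul_zero]; positivity
      · refine mul_le_mul (hM' _ _ ((abs_sub _ _).trans (add_le_add hθ (hfS t htT _ _ h0).1)))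
          ((hC (t, p) ⟨ht, hp⟩).trans (le_abs_self C)) (norm_nonneg _) hM'0
    · intro p hp
      rw [velocityIntegrand_eq]
      by_contra h0
      obtain ⟨h1, h2⟩ := hfρ t htT _ _ (right_ne_zero_of_mul h0)
      exact hp ⟨abs_le.1 h1, abs_le.1 h2⟩
  · have hdt : DifferentiableAt ℝ (fun s => f s θ r) t :=
      ((hf.comp (contDiff_id.prodMk (contDiff_const (c := ((θ, r) : ℝ × ℝ)))) :
        ContDiff ℝ 1 fun s => f s θ r).differentiable one_ne_zero) t
    rw [hdt.derivWithin (uniqueDiffOn_Ico 0 T t ht), (hflux t ht θ r).deriv, add_neg_cancel]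

end Kernel

/-! ### Finite speed of propagation for one-dimensional continuity equations. -/

section FiniteSpeed

open scoped Topology

theorem nonpos_of_hasDerivAt_of_le {ψ : ℝ → ℝ} {d t : ℝ} (h : HasDerivAt ψ d 0) (ht : 0 < t)
    (hle : ∀ s ∈ Icc 0 t, ψ s ≤ ψ 0) : d ≤ 0 := by
  have h1 := (hasDerivWithinAt_iff_tendsto_slope' (s := Ioi (0 : ℝ)) (by simp)).1
    (h.hasDerivWithinAt (s := Ioi 0))
  refine le_of_tendsto h1 ?_
  filter_upwards [Ioc_mem_nhdsGT ht] with s hs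
  rw [slope_def_field]
  exact div_nonpos_of_nonpos_of_nonneg (sub_nonpos.2 (hle s ⟨hs.1.le, hs.2⟩)) (by linarith [hs.1])

theorem hasDerivAt_intervalIntegral_of_continuousOn {f f' : ℝ → ℝ → ℝ} {s : Set ℝ} (hs : IsOpen s)
    (hf : ContinuousOn f.uncurry (s ×ˢ univ)) (hf' : ContinuousOn f'.uncurry (s ×ˢ univ))
    (hd : ∀ t ∈ s, ∀ y, HasDerivAt (fun t => f t y) (f' t y) t) {t : ℝ} (ht : t ∈ s) (x y : ℝ) :
    HasDerivAt (fun t => ∫ u in x..y, f t u) (∫ u in x..y, f' t u) t := by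
  have key : ∀ {x y : ℝ}, x ≤ y →
      HasDerivAt (fun t => ∫ u in x..y, f t u) (∫ u in x..y, f' t u) t := fun {x y} h => by
    simp only [intervalIntegral.integral_of_le h, ← integral_Icc_eq_integral_Ioc]
    exact hasDerivAt_setIntegral_of_continuousOn isCompact_Icc hs
      (hf.mono (prod_mono le_rfl (subset_univ _))) (hf'.mono (prod_mono le_rfl (subset_univ _)))
      (fun t ht y _ => hd t ht y) ht
  rcases le_total x y with h | h
  · exact key h
  · simp only [intervalIntegral.integral_symm y x]
    exact (key h).neg

/-- The interval has length `|c * s|`, so replacing `g s u` by `g 0 y` costs only `o(s)`; continuity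
at one point suffices. -/
theorem hasDerivAt_integral_moving_endpoint {g : ℝ → ℝ → ℝ} {y c : ℝ}
    (hg : ∀ᶠ s in 𝓝 0, Continuous (g s)) (hc : ContinuousAt g.uncurry (0, y)) :
    HasDerivAt (fun s => ∫ u in y..(y + c * s), g s u) (c * g 0 y) 0 := by
  rw [hasDerivAt_iff_isLittleO_nhds_zero, Asymptotics.isLittleO_iff]
  intro ε hε
  obtain ⟨δ, hδ, hball⟩ := Metric.continuousAt_iff.1 hc (ε / (|c| + 1)) (by positivity)
  have h1 : ∀ᶠ s in 𝓝 (0 : ℝ), |s| < δ :=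
    continuous_abs.continuousAt.eventually_lt continuousAt_const (by simpa using hδ)
  have h2 : ∀ᶠ s in 𝓝 (0 : ℝ), |c * s| < δ :=
    (by fun_prop : Continuous fun s : ℝ => |c * s|).continuousAt.eventually_lt
      continuousAt_const (by simpa using hδ)
  filter_upwards [hg, h1, h2] with s hs h1 h2
  have e : (∫ u in y..(y + c * (0 + s)), g (0 + s) u) - (∫ u in y..(y + c * 0), g 0 u)
      - s • (c * g 0 y) = ∫ u in y..(y + c * s), (g s u - g 0 y) := by
    rw [intervalIntegral.integral_sub (hs.intervalIntegrable _ _)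
      (continuous_const.intervalIntegrable _ _)]
    simp
    ring
  rw [e]
  have hb : ∀ u ∈ uIoc y (y + c * s), ‖g s u - g 0 y‖ ≤ ε / (|c| + 1) := fun u hu => by
    have hu' : |u - y| ≤ |c * s| := by
      have := abs_sub_left_of_mem_uIcc (uIoc_subset_uIcc hu)
      simpa using this
    refine (hball (x := (s, u)) ?_).le
    rw [Prod.dist_eq, Real.dist_eq, Real.dist_eq, sub_zero]
    exact max_lt h1 (hu'.trans_lt h2)
  refine (intervalIntegral.norm_integral_le_of_norm_le_const hb).trans ?_
  rw [add_sub_cancel_left, abs_mul, Real.norm_eq_abs, ← mul_assoc]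
  gcongr
  rw [div_mul_eq_mul_div, div_le_iff₀ (by positivity)]
  gcongr
  linarith

/-- Finite speed of propagation for a continuity equation `∂ₜ f + ∂ₓ q = 0` whose flux is
controlled by the density, `|q| ≤ M |f|`. -/
theorem eq_zero_of_abs_flux_le {f f' q : ℝ → ℝ → ℝ} {T τ M A B : ℝ} (hτ : τ < T) (hM : 0 ≤ M)
    (hf : ContinuousOn f.uncurry (Ico 0 T ×ˢ univ))
    (hf' : ContinuousOn f'.uncurry (Ioo 0 T ×ˢ univ))
    (hd : ∀ t ∈ Ioo 0 T, ∀ x, HasDerivAt (fun t => f t x) (f' t x) t)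
    (hq : ∀ t ∈ Ioo 0 T, ∀ x, HasDerivAt (q t) (-f' t x) x)
    (hqM : ∀ t ∈ Icc 0 τ, ∀ x, |q t x| ≤ M * |f t x|)
    (h0 : ∀ x ∈ Icc A B, f 0 x = 0) {t x : ℝ} (ht : t ∈ Icc 0 τ) (hx : A + M * t < x)
    (hx' : x < B - M * t) : f t x = 0 := by
  have hτ0 : 0 ≤ τ := ht.1.trans ht.2
  have hfc : ∀ t ∈ Ico 0 T, Continuous (f t) := fun t ht =>
    continuousOn_univ.1 (hf.comp (Continuous.prodMk_right t).continuousOn fun y hy => ⟨ht, hy⟩)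
  have hfc' : ∀ t ∈ Ioo 0 T, Continuous (f' t) := fun t ht =>
    continuousOn_univ.1 (hf'.comp (Continuous.prodMk_right t).continuousOn fun y hy => ⟨ht, hy⟩)
  -- Times with pairs of endpoints in the shrinking interval. The endpoints are not ordered, which
  -- allows them to be swapped at the end.
  set D : Set (ℝ × ℝ × ℝ) := {z | z.1 ∈ Icc 0 τ ∧ z.2.1 ∈ Icc (A + M * z.1) (B - M * z.1) ∧
    z.2.2 ∈ Icc (A + M * z.1) (B - M * z.1)} with hD
  have hDc : IsCompact D := by
    refine IsCompact.of_isClosed_subset ((isCompact_Icc (a := 0) (b := τ)).prod ((isCompact_Icc (a := A) (b := B)).prod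
      (isCompact_Icc (a := A) (b := B)))) ?_ ?_
    · simp only [hD, mem_Icc]
      have hcl : ∀ {p q r : ℝ × ℝ × ℝ → ℝ}, Continuous p → Continuous q → Continuous r →
          IsClosed {z | p z ≤ q z ∧ q z ≤ r z} := fun hp hq hr =>
        (isClosed_le hp hq).and (isClosed_le hq hr)
      exact (hcl (by fun_prop) (by fun_prop) (by fun_prop)).and
        ((hcl (by fun_prop) (by fun_prop) (by fun_prop)).and
          (hcl (by fun_prop) (by fun_prop) (by fun_prop)))
    · rintro z ⟨h1, h2, h3⟩
      have := mul_nonneg hM h1.1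
      exact ⟨h1, ⟨by linarith [h2.1], by linarith [h2.2]⟩, ⟨by linarith [h3.1], by linarith [h3.2]⟩⟩
  set Φ : ℝ × ℝ × ℝ → ℝ := fun z => ∫ u in z.2.1..z.2.2, f z.1 u with hΦ
  have hΦc : ContinuousOn Φ D := by
    set F : ℝ → ℝ → ℝ := fun t u => f (projIcc 0 τ hτ0 t) u with hF
    have hFc : Continuous F.uncurry := by
      refine hf.comp_continuous (f := fun p : ℝ × ℝ => ((projIcc 0 τ hτ0 p.1 : ℝ), p.2))
        (by fun_prop) fun p => ⟨⟨(projIcc 0 τ hτ0 p.1).2.1, ?_⟩, mem_univ _⟩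
      exact (projIcc 0 τ hτ0 p.1).2.2.trans_lt hτ
    have hFc2 : Continuous (fun (z : ℝ × ℝ × ℝ) u => F z.1 u).uncurry :=
      hFc.comp (by fun_prop : Continuous fun p : (ℝ × ℝ × ℝ) × ℝ => (p.1.1, p.2))
    have h1 : Continuous fun z : ℝ × ℝ × ℝ =>
        (∫ u in 0..z.2.2, F z.1 u) - ∫ u in 0..z.2.1, F z.1 u :=
      (intervalIntegral.continuous_parametric_intervalIntegral_of_continuous hFc2
        (by fun_prop)).sub
      (intervalIntegral.continuous_parametric_intervalIntegral_of_continuous hFc2 (by fun_prop))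
    refine h1.continuousOn.congr fun z hz => ?_
    have h2 : F z.1 = f z.1 := by
      ext u
      simp only [hF, projIcc_of_mem hτ0 hz.1]
    have h3 := hfc z.1 ⟨hz.1.1, hz.1.2.trans_lt hτ⟩
    simp only [hΦ, h2]
    rw [intervalIntegral.integral_interval_sub_left (h3.intervalIntegrable _ _)
      (h3.intervalIntegrable _ _)]
  -- Maximum principle for `Φ - ε t`: a maximum at positive time is refuted by going back in time
  -- with moving endpoints. This avoids differentiating `|f|`.
  have key : ∀ ε > 0, ∀ z ∈ D, Φ z ≤ ε * z.1 := by
    intro ε hε z hz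
    obtain ⟨w, hw, hmax⟩ := hDc.exists_isMaxOn ⟨z, hz⟩
      (hΦc.sub (by fun_prop : Continuous fun z : ℝ × ℝ × ℝ => ε * z.1).continuousOn)
    obtain ⟨t, x, y⟩ := w
    obtain ⟨ht, hx, hy⟩ := hw
    dsimp only at ht hx hy
    rcases ht.1.eq_or_lt with h | hpos
    · subst h
      have h1 : Φ (0, x, y) = 0 := by
        refine (intervalIntegral.integral_congr fun u hu => ?_).trans
          intervalIntegral.integral_zero
        refine h0 u (uIcc_subset_Icc ?_ ?_ hu)
        · simpa using hx
        · simpa using hy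
      have h2 : Φ z - ε * z.1 ≤ Φ (0, x, y) - ε * 0 := hmax hz
      rw [h1] at h2
      linarith
    · exfalso
      have htT : t ∈ Ioo 0 T := ⟨hpos, ht.2.trans_lt hτ⟩
      -- With these endpoint speeds the derivative is `q t y - q t x + M |f t y| + M |f t x| + ε`,
      -- at least `ε` by the flux bound. Speeds at most `M` keep the endpoints in the interval,
      -- which widens at speed `M` backwards in time.
      set a : ℝ := -(SignType.sign (f t x) : ℝ) * M with ha
      set c : ℝ := (SignType.sign (f t y) : ℝ) * M with hc
      have hsgn : ∀ v : ℝ, |(SignType.sign v : ℝ)| ≤ 1 := fun v => by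
        rcases lt_trichotomy v 0 with h | h | h <;> simp [h]
      have haM : |a| ≤ M := by
        rw [ha, abs_mul, abs_neg, abs_of_nonneg hM]
        exact mul_le_of_le_one_left hM (hsgn _)
      have hcM : |c| ≤ M := by
        rw [hc, abs_mul, abs_of_nonneg hM]
        exact mul_le_of_le_one_left hM (hsgn _)
      have hfat : ∀ y, ContinuousAt (fun s u => f (t - s) u).uncurry (0, y) := fun y => by
        have h1 : ContinuousAt f.uncurry (t - (0 : ℝ), y) :=
          hf.continuousAt ((prod_mem_nhds (Ico_mem_nhds (by simpa using hpos)
            (by simpa using htT.2)) Filter.univ_mem))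
        exact ContinuousAt.comp (f := fun p : ℝ × ℝ => (t - p.1, p.2)) (x := ((0 : ℝ), y))
          (g := f.uncurry) h1 (by fun_prop)
      have hev : ∀ᶠ s in 𝓝 (0 : ℝ), t - s ∈ Ioo 0 T :=
        (by fun_prop : Continuous fun s : ℝ => t - s).continuousAt.eventually
          (by simpa only [sub_zero] using! Ioo_mem_nhds htT.1 htT.2)
      have hgc : ∀ᶠ s in 𝓝 (0 : ℝ), Continuous (f (t - s)) := by
        filter_upwards [hev] with s hs using hfc _ (Ioo_subset_Ico_self hs)
      have h1 : HasDerivAt (fun s => ∫ u in x..y, f (t - s) u) (-∫ u in x..y, f' t u) 0 := by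
        have h2 := hasDerivAt_intervalIntegral_of_continuousOn isOpen_Ioo
          (hf.mono (prod_mono Ioo_subset_Ico_self le_rfl)) hf' hd htT x y
        rw [← sub_zero t] at h2
        simpa using! HasDerivAt.comp (0 : ℝ) h2 ((hasDerivAt_id (0 : ℝ)).const_sub t)
      have h2 := hasDerivAt_integral_moving_endpoint (c := a) hgc (hfat x)
      have h3 := hasDerivAt_integral_moving_endpoint (c := c) hgc (hfat y)
      have h4 : HasDerivAt (fun s : ℝ => ε * (t - s)) (-ε) 0 := by
        simpa using ((hasDerivAt_id (0 : ℝ)).const_sub t).const_mul ε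
      have h5 := ((h1.add h3).sub h2).sub h4
      have h6 : HasDerivAt (fun s => Φ (t - s, x + a * s, y + c * s) - ε * (t - s))
          (-(∫ u in x..y, f' t u) + c * f (t - 0) y - a * f (t - 0) x - -ε) 0 := by
        refine h5.congr_of_eventuallyEq ?_
        filter_upwards [hgc] with s hs
        have hi : ∀ p q, IntervalIntegrable (f (t - s)) volume p q := fun p q =>
          hs.intervalIntegrable p q
        simp only [hΦ, Pi.add_apply, Pi.sub_apply]
        have := intervalIntegral.integral_add_adjacent_intervals (hi x (x + a * s))
          (hi (x + a * s) (y + c * s))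
        have := intervalIntegral.integral_add_adjacent_intervals (hi x y) (hi y (y + c * s))
        linarith
      have h7 := nonpos_of_hasDerivAt_of_le h6 hpos fun s hs => by
        have hMs : ∀ {v : ℝ}, |v| ≤ M → |v * s| ≤ M * s := fun hv => by
          rw [abs_mul, abs_of_nonneg hs.1]
          exact mul_le_mul_of_nonneg_right hv hs.1
        have ha' := abs_le.1 (hMs haM)
        have hc' := abs_le.1 (hMs hcM)
        have hmem : ((t - s, x + a * s, y + c * s) : ℝ × ℝ × ℝ) ∈ D := by
          refine ⟨⟨sub_nonneg.2 hs.2, by linarith [hs.1, ht.2]⟩, ⟨?_, ?_⟩, ⟨?_, ?_⟩⟩ <;>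
          simp only [mul_sub] <;> linarith [hx.1, hx.2, hy.1, hy.2]
        simpa using! hmax hmem
      have h8 : ∫ u in x..y, f' t u = -(q t y - q t x) := by
        have := intervalIntegral.integral_eq_sub_of_hasDerivAt (a := x) (b := y)
          (fun u _ => hq t htT u) ((hfc' t htT).neg.intervalIntegrable _ _)
        rw [intervalIntegral.integral_neg] at this
        linarith
      have h9 : ∀ v : ℝ, (SignType.sign v : ℝ) * M * v = M * |v| := fun v => by
        rw [← sign_mul_self v]; ring
      have h10 : c * f (t - 0) y = M * |f t y| := by rw [sub_zero, hc, h9]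
      have h11 : a * f (t - 0) x = -(M * |f t x|) := by rw [sub_zero, ha, ← h9]; ring
      rw [h8, h10, h11] at h7
      have hy' := (abs_le.1 (hqM t ht y)).1
      have hx'' := (abs_le.1 (hqM t ht x)).2
      linarith
  have hle : ∀ z ∈ D, Φ z ≤ 0 := fun z hz => by
    refine le_of_forall_pos_le_add fun ε hε => ?_
    have hz1 : 0 ≤ z.1 := hz.1.1
    refine (key (ε / (z.1 + 1)) (by positivity) z hz).trans ?_
    rw [zero_add, div_mul_eq_mul_div, div_le_iff₀ (by positivity)]
    gcongr
    linarith
  -- Swapping the endpoints changes the sign of `Φ`, so the one-sided bound gives equality.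
  have hzero : ∀ y ∈ Icc (A + M * t) (B - M * t), ∫ u in x..y, f t u = 0 := fun y hy => by
    have h1 : ((t, x, y) : ℝ × ℝ × ℝ) ∈ D := ⟨ht, ⟨hx.le, hx'.le⟩, hy⟩
    have h2 : ((t, y, x) : ℝ × ℝ × ℝ) ∈ D := ⟨ht, hy, ⟨hx.le, hx'.le⟩⟩
    have h3 := hle _ h1
    have h4 := hle _ h2
    simp only [hΦ] at h3 h4
    rw [intervalIntegral.integral_symm] at h4
    linarith
  have hc := hfc t ⟨ht.1, ht.2.trans_lt hτ⟩
  have h1 : HasDerivAt (fun y => ∫ u in x..y, f t u) (f t x) x :=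
    (hc.integral_hasStrictDerivAt x x).hasDerivAt
  refine h1.unique ((hasDerivAt_const x (0 : ℝ)).congr_of_eventuallyEq ?_)
  filter_upwards [Icc_mem_nhds hx hx'] with y hy using hzero y hy

end FiniteSpeed

/-! ### The `L²` estimate for the difference of two solutions. -/

section Energy

open scoped Topology

/-- Cauchy–Schwarz, read off from `∫ (m |h| - N)² ≥ 0` with `m` the volume and `N` the integral of
`|h|`. -/
theorem sq_setIntegral_abs_le {Q : Set (ℝ × ℝ)} (hQ : IsCompact Q) {h : ℝ × ℝ → ℝ}
    (hh : Continuous h) :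
    (∫ p in Q, |h p|) ^ 2 ≤ volume.real Q * ∫ p in Q, h p ^ 2 := by
  set N := ∫ p in Q, |h p| with hN
  set m := volume.real Q with hm
  set e := ∫ p in Q, h p ^ 2 with he
  have hm0 : 0 ≤ m := measureReal_nonneg
  have hi1 : IntegrableOn (fun p => |h p|) Q := hh.abs.continuousOn.integrableOn_compact hQ
  have hi2 : IntegrableOn (fun p => h p ^ 2) Q := (hh.pow 2).continuousOn.integrableOn_compact hQ
  have hc : IntegrableOn (fun _ : ℝ × ℝ => N ^ 2) Q := integrableOn_const hQ.measure_lt_top.ne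
  have h1 : 0 ≤ ∫ p in Q, (m * |h p| - N) ^ 2 := integral_nonneg fun p => sq_nonneg _
  have h2 : ∫ p in Q, (m * |h p| - N) ^ 2 = m ^ 2 * e - 2 * m * N * N + m * N ^ 2 := by
    have e1 : ∀ p, (m * |h p| - N) ^ 2 = m ^ 2 * h p ^ 2 - 2 * m * N * |h p| + N ^ 2 := fun p => by
      rw [← sq_abs (h p)]; ring
    simp only [e1]
    have hi3 : IntegrableOn (fun p => m ^ 2 * h p ^ 2 - 2 * m * N * |h p|) Q :=
      (hi2.const_mul _).sub (hi1.const_mul _)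
    rw [integral_add hi3 hc,
      integral_sub (hi2.const_mul _) (hi1.const_mul _), integral_const_mul, integral_const_mul,
      setIntegral_const, smul_eq_mul]
  rw [h2] at h1
  rcases hm0.eq_or_lt with h | hpos
  · have : volume Q = 0 := by
      rw [hm, eq_comm, measureReal_eq_zero_iff hQ.measure_lt_top.ne] at h
      exact h
    have hN0 : N = 0 := by rw [hN, Measure.restrict_eq_zero.2 this, integral_zero_measure]
    simp [hN0, ← h]
  · refine le_of_mul_le_mul_left ?_ hpos
    linarith

theorem integral_eq_zero_of_hasDerivAt_of_bounded_support {F D : ℝ × ℝ → ℝ} (hF : Continuous F)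
    (hD : Continuous D) {ρ : ℝ} (hFs : ∀ p, F p ≠ 0 → |p.1| ≤ ρ ∧ |p.2| ≤ ρ)
    (hDs : ∀ p, D p ≠ 0 → |p.1| ≤ ρ ∧ |p.2| ≤ ρ)
    (hd : ∀ θ x, HasDerivAt (fun y => F (θ, y)) (D (θ, x)) x) : ∫ p, D p = 0 := by
  have hi := integrable_of_continuous_of_bounded_support hD hDs
  rw [Measure.volume_eq_prod] at hi ⊢
  rw [integral_prod _ hi]
  have hint : ∀ {g : ℝ × ℝ → ℝ} (θ : ℝ), Continuous g → (∀ p, g p ≠ 0 → |p.1| ≤ ρ ∧ |p.2| ≤ ρ) →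
      Integrable fun x => g (θ, x) := fun {g} θ hg hs =>
    (hg.comp (Continuous.prodMk_right θ)).integrable_of_hasCompactSupport
      (HasCompactSupport.intro (isCompact_Icc (a := -ρ) (b := ρ)) fun x hx => by
        by_contra h
        exact hx (abs_le.1 (hs (θ, x) h).2))
  have : ∀ θ, ∫ x, D (θ, x) = 0 := fun θ =>
    integral_eq_zero_of_hasDerivAt_of_integrable (hd θ) (hint θ hD hDs) (hint θ hF hFs)
  simp [this]

theorem displacedAverage_sub {Q : Set (ℝ × ℝ)} (hQ : IsCompact Q) {κ f g u : ℝ × ℝ → ℝ}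
    (hκ : Continuous κ) (hf : Continuous f) (hg : Continuous g) (hu : Continuous u) (q : ℝ × ℝ) :
    displacedAverage Q κ g u q - displacedAverage Q κ f u q
      = displacedAverage Q κ (fun p => g p - f p) u q := by
  have hint : ∀ {g : ℝ × ℝ → ℝ}, Continuous g →
      IntegrableOn (fun p => κ (q.1 - p.1, q.2 - p.2 - u p) * g p) Q := fun hg =>
    (by fun_prop : Continuous fun p => κ (q.1 - p.1, q.2 - p.2 - u p) * _)
      |>.continuousOn.integrableOn_compact hQ
  simp only [displacedAverage, mul_sub]
  exact (integral_sub (hint hg) (hint hf)).symm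

/-- The energy estimate for the difference of two solutions of the nonlocal transport equation, at
a fixed time. -/
theorem integral_sub_mul_sub_le {ρ L B : ℝ} (hρ : 0 ≤ ρ) {k k' F G Fx Gx Ft Gt : ℝ × ℝ → ℝ}
    (hk : Continuous k) (hk' : Continuous k')
    (hkd : ∀ η x, HasDerivAt (fun x => k (η, x)) (k' (η, x)) x)
    (hF : Continuous F) (hG : Continuous G) (hFx : Continuous Fx) (hGx : Continuous Gx)
    (hFt : Continuous Ft) (hGt : Continuous Gt)
    (hFs : ∀ p, F p ≠ 0 → |p.1| ≤ ρ ∧ |p.2| ≤ ρ) (hGs : ∀ p, G p ≠ 0 → |p.1| ≤ ρ ∧ |p.2| ≤ ρ)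
    (hFd : ∀ θ x, HasDerivAt (fun x => F (θ, x)) (Fx (θ, x)) x)
    (hGd : ∀ θ x, HasDerivAt (fun x => G (θ, x)) (Gx (θ, x)) x)
    (hFe : ∀ θ x, HasDerivAt (fun x => displacedAverage (Icc (-ρ) ρ ×ˢ Icc (-ρ) ρ) k F 0 (θ, x)
      * F (θ, x)) (-Ft (θ, x)) x)
    (hGe : ∀ θ x, HasDerivAt (fun x => displacedAverage (Icc (-ρ) ρ ×ˢ Icc (-ρ) ρ) k G 0 (θ, x)
      * G (θ, x)) (-Gt (θ, x)) x)
    (hkL : ∀ p : ℝ × ℝ, |p.1| ≤ 2 * ρ → |p.2| ≤ 2 * ρ → |k p| ≤ L)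
    (hkL' : ∀ p : ℝ × ℝ, |p.1| ≤ 2 * ρ → |p.2| ≤ 2 * ρ → |k' p| ≤ L)
    (hFB : ∀ p ∈ Icc (-ρ) ρ ×ˢ Icc (-ρ) ρ, |F p| ≤ B)
    (hGB : ∀ p ∈ Icc (-ρ) ρ ×ˢ Icc (-ρ) ρ, |G p| ≤ B)
    (hFxB : ∀ p ∈ Icc (-ρ) ρ ×ˢ Icc (-ρ) ρ, |Fx p| ≤ B) :
    ∫ p in Icc (-ρ) ρ ×ˢ Icc (-ρ) ρ, 2 * (G p - F p) * (Gt p - Ft p)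
      ≤ 5 * L * B * volume.real (Icc (-ρ) ρ ×ˢ Icc (-ρ) ρ : Set (ℝ × ℝ))
        * ∫ p in Icc (-ρ) ρ ×ˢ Icc (-ρ) ρ, (G p - F p) ^ 2 := by
  set Q : Set (ℝ × ℝ) := Icc (-ρ) ρ ×ˢ Icc (-ρ) ρ with hQdef
  have hQ : IsCompact Q := isCompact_Icc.prod isCompact_Icc
  have h0Q : (0 : ℝ × ℝ) ∈ Q := by
    refine ⟨?_, ?_⟩ <;> simpa using hρ
  have hL0 : 0 ≤ L := (abs_nonneg _).trans (hkL 0 (by simpa) (by simpa))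
  have hB0 : 0 ≤ B := (abs_nonneg _).trans (hFB 0 h0Q)
  have h0c : Continuous (0 : ℝ × ℝ → ℝ) := continuous_zero
  set m := volume.real Q with hm
  have hm0 : 0 ≤ m := measureReal_nonneg
  set h : ℝ × ℝ → ℝ := fun p => G p - F p with hh
  have hhc : Continuous h := hG.sub hF
  have hhs : ∀ p, h p ≠ 0 → |p.1| ≤ ρ ∧ |p.2| ≤ ρ := fun p hp => by
    by_cases hFp : F p = 0
    · exact hGs p fun h0 => hp (by simp [hh, hFp, h0])
    · exact hFs p hFp
  set N := ∫ p in Q, |h p| with hN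
  have hN0 : 0 ≤ N := integral_nonneg fun _ => abs_nonneg _
  set aF := displacedAverage Q k F 0 with haF
  set aG := displacedAverage Q k G 0 with haG
  set aF' := displacedAverage Q k' F 0 with haF'
  set aG' := displacedAverage Q k' G 0 with haG'
  have haGc : Continuous aG := continuous_displacedAverage hQ hk hG h0c
  have haGc' : Continuous aG' := continuous_displacedAverage hQ hk' hG h0c
  have haFd : ∀ θ x, HasDerivAt (fun x => aF (θ, x)) (aF' (θ, x)) x := fun θ x =>
    hasDerivAt_displacedAverage hQ hk hk' hkd hF h0c θ x
  have haGd : ∀ θ x, HasDerivAt (fun x => aG (θ, x)) (aG' (θ, x)) x := fun θ x =>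
    hasDerivAt_displacedAverage hQ hk hk' hkd hG h0c θ x
  have hQ2 : ∀ {κ : ℝ × ℝ → ℝ}, (∀ p : ℝ × ℝ, |p.1| ≤ 2 * ρ → |p.2| ≤ 2 * ρ → |κ p| ≤ L) →
      ∀ q ∈ Q, ∀ p ∈ Q, |κ (q.1 - p.1, q.2 - p.2 - (0 : ℝ × ℝ → ℝ) p)| ≤ L := by
    intro κ hκ q hq p hp
    have h1 := abs_le.2 hq.1
    have h2 := abs_le.2 hq.2
    have h3 := abs_le.2 hp.1
    have h4 := abs_le.2 hp.2
    refine hκ _ ((abs_sub _ _).trans (by linarith)) ?_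
    simp only [Pi.zero_apply, sub_zero]
    exact (abs_sub _ _).trans (by linarith)
  have hda : ∀ q ∈ Q, |aG q - aF q| ≤ L * N := fun q hq => by
    rw [haG, haF, displacedAverage_sub hQ hk hF hG h0c]
    exact abs_displacedAverage_le hQ hhc fun p hp _ => hQ2 hkL q hq p hp
  have hda' : ∀ q ∈ Q, |aG' q - aF' q| ≤ L * N := fun q hq => by
    rw [haG', haF', displacedAverage_sub hQ hk' hF hG h0c]
    exact abs_displacedAverage_le hQ hhc fun p hp _ => hQ2 hkL' q hq p hp
  have hGN : ∫ p in Q, |G p| ≤ B * m := by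
    have := norm_setIntegral_le_of_norm_le_const (μ := volume) (f := fun p => |G p|) (C := B)
      hQ.measure_lt_top fun p hp => by simpa using hGB p hp
    exact (le_abs_self _).trans this
  have haGB : ∀ q ∈ Q, |aG' q| ≤ L * (B * m) := fun q hq =>
    (abs_displacedAverage_le hQ hG fun p hp _ => hQ2 hkL' q hq p hp).trans (by gcongr)
  have hft : ∀ p, Ft p = -(aF' p * F p + aF p * Fx p) := fun p => by
    have := (hFe p.1 p.2).unique ((haFd p.1 p.2).mul (hFd p.1 p.2))
    simp only [Prod.mk.eta] at this
    linarith
  have hgt : ∀ p, Gt p = -(aG' p * G p + aG p * Gx p) := fun p => by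
    have := (hGe p.1 p.2).unique ((haGd p.1 p.2).mul (hGd p.1 p.2))
    simp only [Prod.mk.eta] at this
    linarith
  -- This is `∂ₓ (aG h²)`, which integrates to zero. It absorbs the only term with a derivative of
  -- `h`, so no bound on `Gx` is needed.
  set D : ℝ × ℝ → ℝ := fun p => aG' p * h p ^ 2 + aG p * (2 * h p * (Gx p - Fx p)) with hD
  have hDc : Continuous D := by fun_prop
  have hDs : ∀ p, D p ≠ 0 → |p.1| ≤ ρ ∧ |p.2| ≤ ρ := fun p hp =>
    hhs p fun h0 => hp (by simp [hD, h0])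
  have hD0 : ∫ p in Q, D p = 0 := by
    rw [setIntegral_eq_integral_of_forall_compl_eq_zero]
    · refine integral_eq_zero_of_hasDerivAt_of_bounded_support (F := fun p => aG p * h p ^ 2)
        (ρ := ρ) (by fun_prop) hDc (fun p hp => hhs p fun h0 => hp (by simp [h0])) hDs
        fun θ x => ?_
      refine ((haGd θ x).mul (((hGd θ x).sub (hFd θ x)).pow 2)).congr_deriv ?_
      simp [hD, hh]
    · intro p hp
      by_contra h0
      exact hp ⟨abs_le.1 (hDs p h0).1, abs_le.1 (hDs p h0).2⟩
  -- What remains is `-aG' h²` and the terms where the difference of velocities meets `F` and `Fx`.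
  -- They contribute 1 and 4 to the final constant 5.
  have hpt : ∀ p ∈ Q, 2 * h p * (Gt p - Ft p)
      ≤ -D p + L * (B * m) * h p ^ 2 + 4 * L * B * N * |h p| := by
    intro p hp
    have e : 2 * h p * (Gt p - Ft p) = -D p + (-aG' p) * h p ^ 2
        + -(2 * (h p * ((aG' p - aF' p) * F p + (aG p - aF p) * Fx p))) := by
      rw [hgt, hft, hD]
      simp only [hh]
      ring
    rw [e]
    have h1 : (-aG' p) * h p ^ 2 ≤ L * (B * m) * h p ^ 2 := by
      gcongr
      exact (neg_le_abs _).trans (haGB p hp)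
    have h2 : |(aG' p - aF' p) * F p + (aG p - aF p) * Fx p| ≤ L * N * B + L * N * B := by
      refine (abs_add_le _ _).trans ?_
      rw [abs_mul, abs_mul]
      gcongr
      · exact hda' p hp
      · exact hFB p hp
      · exact hda p hp
      · exact hFxB p hp
    have h3 : -(2 * (h p * ((aG' p - aF' p) * F p + (aG p - aF p) * Fx p)))
        ≤ 4 * L * B * N * |h p| := by
      have h4 := neg_le_abs (h p * ((aG' p - aF' p) * F p + (aG p - aF p) * Fx p))
      rw [abs_mul] at h4
      have h5 := mul_le_mul_of_nonneg_left h2 (abs_nonneg (h p))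
      linarith
    linarith
  have hi : ∀ {g : ℝ × ℝ → ℝ}, Continuous g → IntegrableOn g Q := fun hg =>
    hg.continuousOn.integrableOn_compact hQ
  have hiD : IntegrableOn (fun p => -D p) Q := hi hDc.neg
  have hi2 : IntegrableOn (fun p => L * (B * m) * h p ^ 2) Q := hi (by fun_prop)
  have hi12 : IntegrableOn (fun p => -D p + L * (B * m) * h p ^ 2) Q := hiD.add hi2
  have hi3 : IntegrableOn (fun p => 4 * L * B * N * |h p|) Q := hi (by fun_prop)
  calc ∫ p in Q, 2 * h p * (Gt p - Ft p)
      ≤ ∫ p in Q, (-D p + L * (B * m) * h p ^ 2 + 4 * L * B * N * |h p|) :=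
        setIntegral_mono_on (hi (by fun_prop)) (hi12.add hi3) hQ.measurableSet hpt
    _ = L * (B * m) * (∫ p in Q, h p ^ 2) + 4 * L * B * N ^ 2 := by
        rw [integral_add hi12 hi3, integral_add hiD hi2, integral_neg, hD0,
          integral_const_mul, integral_const_mul]
        ring
    _ ≤ L * (B * m) * (∫ p in Q, h p ^ 2) + 4 * L * B * (m * ∫ p in Q, h p ^ 2) := by
        gcongr
        exact sq_setIntegral_abs_le hQ hhc
    _ = _ := by ring

end Energy

/-! ### Support bounds and uniqueness of classical solutions. -/

section Uniqueness

open scoped Topology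

namespace IsClassicalSolution

variable {w b : ℝ → ℝ} {σ T : ℝ} {f₀ : ℝ → ℝ → ℝ} {f g : ℝ → ℝ → ℝ → ℝ}

theorem continuousOn (hg : IsClassicalSolution w b σ f₀ T g) :
    ContinuousOn (fun t (p : ℝ × ℝ) => g t p.1 p.2).uncurry (Ico 0 T ×ˢ univ) :=
  hg.contDiffOn.continuousOn

theorem continuous (hg : IsClassicalSolution w b σ f₀ T g) {t : ℝ} (ht : t ∈ Ico 0 T) :
    Continuous fun p : ℝ × ℝ => g t p.1 p.2 :=
  continuousOn_univ.1 (hg.continuousOn.comp (Continuous.prodMk_right t).continuousOn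
    fun _ _ => ⟨ht, mem_univ _⟩)

/-- The equation makes the `r`-derivative of the flux equal to `-gt`, hence continuous, although the
velocity itself is not known to be differentiable. -/
theorem exists_partial_derivatives (hg : IsClassicalSolution w b σ f₀ T g) :
    ∃ gt gx : ℝ → ℝ × ℝ → ℝ, ContinuousOn gt.uncurry (Ico 0 T ×ˢ univ) ∧
      ContinuousOn gx.uncurry (Ico 0 T ×ˢ univ) ∧ ∀ t ∈ Ioo 0 T, ∀ p : ℝ × ℝ,
        HasDerivAt (fun s => g s p.1 p.2) (gt t p) t ∧
        HasDerivAt (fun y => g t p.1 y) (gx t p) p.2 ∧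
        HasDerivAt (fun y => velocity w b σ (g t) p.1 y * g t p.1 y) (-gt t p) p.2 := by
  set F : ℝ × ℝ × ℝ → ℝ := fun p => g p.1 p.2.1 p.2.2 with hF
  set S : Set (ℝ × ℝ × ℝ) := Ico 0 T ×ˢ univ with hS
  have hu : UniqueDiffOn ℝ S := (uniqueDiffOn_Ico 0 T).prod uniqueDiffOn_univ
  have hc := hg.contDiffOn.continuousOn_fderivWithin hu le_rfl
  refine ⟨fun t p => fderivWithin ℝ F S (t, p) (1, 0), fun t p => fderivWithin ℝ F S (t, p) (0, 0, 1),
    hc.clm_apply continuousOn_const, hc.clm_apply continuousOn_const, fun t ht p => ?_⟩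
  have htc : t ∈ Ico 0 T := Ioo_subset_Ico_self ht
  have hmem : S ∈ 𝓝 (t, p) := prod_mem_nhds (Ico_mem_nhds ht.1 ht.2) Filter.univ_mem
  have hd : HasFDerivAt F (fderivWithin ℝ F S (t, p)) (t, p) :=
    ((hg.contDiffOn.differentiableOn one_ne_zero) (t, p)
      ⟨htc, mem_univ _⟩).hasFDerivWithinAt.hasFDerivAt hmem
  have h1 : HasDerivAt (fun s => g s p.1 p.2) (fderivWithin ℝ F S (t, p) (1, 0)) t :=
    HasFDerivAt.comp_hasDerivAt (f := fun s : ℝ => (s, p)) t hd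
      ((hasDerivAt_id t).prodMk (hasDerivAt_const t p))
  refine ⟨h1, ?_, ?_⟩
  · exact HasFDerivAt.comp_hasDerivAt (f := fun y : ℝ => (t, p.1, y)) p.2 hd
      ((hasDerivAt_const _ _).prodMk ((hasDerivAt_const _ _).prodMk (hasDerivAt_id _)))
  · have h2 := hg.equation t htc p.1 p.2
    rw [derivWithin_of_mem_nhds (Ico_mem_nhds ht.1 ht.2), h1.deriv, add_comm] at h2
    rw [← eq_neg_of_add_eq_zero_left h2]
    exact (hg.flux_differentiable t htc p.1 p.2).hasDerivAt

/-- Finite speed of propagation: on compact time intervals, classical solutions are supported in a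
common compact set. -/
theorem exists_support_bound (hg : IsClassicalSolution w b σ f₀ T g) {R : ℝ}
    (hR : ∀ p : ℝ × ℝ, f₀ p.1 p.2 ≠ 0 → |p.1| ≤ R ∧ |p.2| ≤ R) {τ : ℝ} (hτ : τ < T) :
    ∃ ρ, ∀ t ∈ Icc 0 τ, ∀ p : ℝ × ℝ, g t p.1 p.2 ≠ 0 → |p.1| ≤ ρ ∧ |p.2| ≤ ρ := by
  obtain ⟨gt, gx, hgt, -, hd⟩ := hg.exists_partial_derivatives
  have key : ∀ (θ M A B : ℝ), 0 ≤ M →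
      (∀ t ∈ Icc 0 τ, ∀ r, |velocity w b σ (g t) θ r| ≤ M) →
      (∀ x ∈ Icc A B, f₀ θ x = 0) → ∀ t ∈ Icc 0 τ, ∀ x, A + M * t < x → x < B - M * t →
      g t θ x = 0 := by
    intro θ M A B hM hv h0 t ht x hx hx'
    refine eq_zero_of_abs_flux_le (f := fun t x => g t θ x) (f' := fun t x => gt t (θ, x))
      (q := fun t x => velocity w b σ (g t) θ x * g t θ x) hτ hM ?_ ?_
      (fun t ht x => (hd t ht (θ, x)).1) (fun t ht x => (hd t ht (θ, x)).2.2)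
      (fun t ht x => ?_) (fun x hx => ?_) ht hx hx'
    · exact hg.continuousOn.comp (f := fun p : ℝ × ℝ => (p.1, θ, p.2))
        (by fun_prop : Continuous fun p : ℝ × ℝ => (p.1, θ, p.2)).continuousOn
        fun p hp => ⟨hp.1, mem_univ _⟩
    · exact hgt.comp (f := fun p : ℝ × ℝ => (p.1, θ, p.2))
        (by fun_prop : Continuous fun p : ℝ × ℝ => (p.1, θ, p.2)).continuousOn
        fun p hp => ⟨Ioo_subset_Ico_self hp.1, mem_univ _⟩
    · rw [abs_mul]
      exact mul_le_mul_of_nonneg_right (hv t ht x) (abs_nonneg _)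
    · exact (hg.initial θ x).trans (h0 x hx)
  obtain ⟨M, hM⟩ := hg.velocity_bounded τ hτ R
  refine ⟨R + |M| * |τ|, fun t ht p hp => ?_⟩
  have hρ : 0 ≤ |M| * |τ| := by positivity
  -- For `|θ| > R` the initial datum vanishes on the whole line, so any interval works, with the
  -- velocity bound belonging to that `θ`.
  have h1 : |p.1| ≤ R := by
    by_contra h
    obtain ⟨M', hM'⟩ := hg.velocity_bounded τ hτ |p.1|
    refine hp (key p.1 |M'| (p.2 - |M'| * t - 1) (p.2 + |M'| * t + 1) (abs_nonneg _)
      (fun t ht r => (hM' t ht _ le_rfl r).trans (le_abs_self _)) (fun x _ => ?_) t ht p.2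
      (by linarith) (by linarith))
    by_contra h0
    exact h (hR (p.1, x) h0).1
  refine ⟨by linarith, ?_⟩
  by_contra h
  rw [not_le] at h
  have hMt : |M| * t ≤ |M| * |τ| := by
    gcongr
    exact ht.2.trans (le_abs_self _)
  have hv : ∀ t ∈ Icc 0 τ, ∀ r, |velocity w b σ (g t) p.1 r| ≤ |M| := fun t ht r =>
    (hM t ht _ h1 r).trans (le_abs_self _)
  rcases lt_abs.1 h with h | h
  · refine hp (key p.1 |M| ((R + (p.2 - |M| * t)) / 2) (p.2 + |M| * t + 1) (abs_nonneg _) hv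
      (fun x hx => ?_) t ht p.2 (by linarith) (by linarith))
    by_contra h0
    have := (le_abs_self x).trans (hR (p.1, x) h0).2
    linarith [hx.1]
  · refine hp (key p.1 |M| (p.2 - |M| * t - 1) ((-R + (p.2 + |M| * t)) / 2) (abs_nonneg _) hv
      (fun x hx => ?_) t ht p.2 (by linarith) (by linarith))
    by_contra h0
    have := (neg_le_abs x).trans (hR (p.1, x) h0).2
    linarith [hx.2]

/-- Grönwall for the squared `L²` distance `E` on a square `Q` containing both supports: `exp (-C t)
* E t` decreases from 0. The kernel needs no cutoff, since only differences of points of `Q` enter.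
-/
theorem eq_on_Icc (hb : IsOutcomeFunction b) (hw : IsInteractionRate w)
    (hf : IsClassicalSolution w b σ f₀ T f) (hg : IsClassicalSolution w b σ f₀ T g) {R : ℝ}
    (hR : ∀ p : ℝ × ℝ, f₀ p.1 p.2 ≠ 0 → |p.1| ≤ R ∧ |p.2| ≤ R) {τ : ℝ}
    (hτ0 : 0 ≤ τ) (hτ : τ < T) (θ r : ℝ) : g τ θ r = f τ θ r := by
  obtain ⟨ρ, hρ, hfs, hgs⟩ : ∃ ρ, 0 ≤ ρ ∧
      (∀ t ∈ Icc 0 τ, ∀ p : ℝ × ℝ, f t p.1 p.2 ≠ 0 → |p.1| ≤ ρ ∧ |p.2| ≤ ρ) ∧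
      (∀ t ∈ Icc 0 τ, ∀ p : ℝ × ℝ, g t p.1 p.2 ≠ 0 → |p.1| ≤ ρ ∧ |p.2| ≤ ρ) := by
    obtain ⟨ρ₁, h₁⟩ := hf.exists_support_bound hR hτ
    obtain ⟨ρ₂, h₂⟩ := hg.exists_support_bound hR hτ
    refine ⟨max 0 (max ρ₁ ρ₂), le_max_left _ _, fun t ht p hp => ?_, fun t ht p hp => ?_⟩
    · exact (h₁ t ht p hp).imp
        (fun h => h.trans (by simp)) (fun h => h.trans (by simp))
    · exact (h₂ t ht p hp).imp
        (fun h => h.trans (by simp)) (fun h => h.trans (by simp))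
  set Q : Set (ℝ × ℝ) := Icc (-ρ) ρ ×ˢ Icc (-ρ) ρ with hQdef
  have hQ : IsCompact Q := isCompact_Icc.prod isCompact_Icc
  have hIco : Icc 0 τ ⊆ Ico 0 T := fun t ht => ⟨ht.1, ht.2.trans_lt hτ⟩
  obtain ⟨ft, fx, hft, hfx, hfd⟩ := hf.exists_partial_derivatives
  obtain ⟨gt, gx, hgt, hgx, hgd⟩ := hg.exists_partial_derivatives
  have hslice : ∀ {u : ℝ → ℝ × ℝ → ℝ}, ContinuousOn u.uncurry (Ico 0 T ×ˢ univ) →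
      ∀ t ∈ Ico 0 T, Continuous (u t) := fun hu t ht =>
    continuousOn_univ.1 (hu.comp (Continuous.prodMk_right t).continuousOn
      fun _ _ => ⟨ht, mem_univ _⟩)
  set k := interactionKernel w b σ with hk
  have hk1 : ContDiff ℝ 1 k := contDiff_interactionKernel hb hw σ
  set k' : ℝ × ℝ → ℝ := fun p => fderiv ℝ k p (0, 1) with hk'
  have hkc' : Continuous k' := (hk1.continuous_fderiv one_ne_zero).clm_apply continuous_const
  have hkd : ∀ η x, HasDerivAt (fun x => k (η, x)) (k' (η, x)) x := fun η x =>
    HasFDerivAt.comp_hasDerivAt (f := fun x : ℝ => (η, x)) x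
      (hk1.differentiable one_ne_zero (η, x)).hasFDerivAt
      ((hasDerivAt_const _ _).prodMk (hasDerivAt_id _))
  obtain ⟨L, hkL, hkL'⟩ : ∃ L, (∀ p : ℝ × ℝ, |p.1| ≤ 2 * ρ → |p.2| ≤ 2 * ρ → |k p| ≤ L) ∧
      ∀ p : ℝ × ℝ, |p.1| ≤ 2 * ρ → |p.2| ≤ 2 * ρ → |k' p| ≤ L := by
    have hQ2 := (isCompact_Icc (a := -(2 * ρ)) (b := 2 * ρ)).prod
      (isCompact_Icc (a := -(2 * ρ)) (b := 2 * ρ))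
    obtain ⟨L₁, h₁⟩ := hQ2.exists_bound_of_continuousOn hk1.continuous.continuousOn
    obtain ⟨L₂, h₂⟩ := hQ2.exists_bound_of_continuousOn hkc'.continuousOn
    exact ⟨max L₁ L₂, fun p h h' => (h₁ p ⟨abs_le.1 h, abs_le.1 h'⟩).trans (le_max_left _ _),
      fun p h h' => (h₂ p ⟨abs_le.1 h, abs_le.1 h'⟩).trans (le_max_right _ _)⟩
  obtain ⟨B, hfB, hgB, hfxB⟩ : ∃ B, (∀ t ∈ Icc 0 τ, ∀ p ∈ Q, |f t p.1 p.2| ≤ B) ∧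
      (∀ t ∈ Icc 0 τ, ∀ p ∈ Q, |g t p.1 p.2| ≤ B) ∧ ∀ t ∈ Icc 0 τ, ∀ p ∈ Q, |fx t p| ≤ B := by
    have hK := (isCompact_Icc (a := 0) (b := τ)).prod hQ
    have hsub : Icc 0 τ ×ˢ Q ⊆ Ico 0 T ×ˢ (univ : Set (ℝ × ℝ)) :=
      prod_mono hIco (subset_univ _)
    obtain ⟨B₁, h₁⟩ := hK.exists_bound_of_continuousOn (hf.continuousOn.mono hsub)
    obtain ⟨B₂, h₂⟩ := hK.exists_bound_of_continuousOn (hg.continuousOn.mono hsub)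
    obtain ⟨B₃, h₃⟩ := hK.exists_bound_of_continuousOn (hfx.mono hsub)
    refine ⟨max B₁ (max B₂ B₃), fun t ht p hp => ?_, fun t ht p hp => ?_, fun t ht p hp => ?_⟩
    · exact (h₁ (t, p) ⟨ht, hp⟩).trans (le_max_left _ _)
    · exact (h₂ (t, p) ⟨ht, hp⟩).trans ((le_max_left _ _).trans (le_max_right _ _))
    · exact (h₃ (t, p) ⟨ht, hp⟩).trans ((le_max_right _ _).trans (le_max_right _ _))
  have hvel : ∀ {u : ℝ → ℝ → ℝ}, (∀ p : ℝ × ℝ, u p.1 p.2 ≠ 0 → |p.1| ≤ ρ ∧ |p.2| ≤ ρ) →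
      ∀ θ x, velocity w b σ u θ x = displacedAverage Q k (fun p => u p.1 p.2) 0 (θ, x) := by
    intro u hu θ x
    simp only [displacedAverage, Pi.zero_apply, sub_zero]
    rw [setIntegral_eq_integral_of_forall_compl_eq_zero]
    · rfl
    · intro p hp
      by_contra h0
      obtain ⟨h1, h2⟩ := hu p (right_ne_zero_of_mul h0)
      exact hp ⟨abs_le.1 h1, abs_le.1 h2⟩
  set E : ℝ → ℝ := fun t => ∫ p in Q, (g t p.1 p.2 - f t p.1 p.2) ^ 2 with hE
  set C := 5 * L * B * volume.real Q with hC
  have hEd : ∀ t ∈ Ioo 0 T, HasDerivAt E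
      (∫ p in Q, 2 * (g t p.1 p.2 - f t p.1 p.2) * (gt t p - ft t p)) t := fun t ht => by
    have hsub : Ioo 0 T ×ˢ Q ⊆ Ico 0 T ×ˢ (univ : Set (ℝ × ℝ)) :=
      prod_mono Ioo_subset_Ico_self (subset_univ _)
    have hsubc : ContinuousOn (fun z : ℝ × ℝ × ℝ => g z.1 z.2.1 z.2.2 - f z.1 z.2.1 z.2.2)
        (Ioo 0 T ×ˢ Q) := (hg.continuousOn.mono hsub).sub (hf.continuousOn.mono hsub)
    have hsq : ContinuousOn (fun z : ℝ × ℝ × ℝ => (g z.1 z.2.1 z.2.2 - f z.1 z.2.1 z.2.2) ^ 2)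
        (Ioo 0 T ×ˢ Q) := hsubc.pow 2
    have hprod : ContinuousOn (fun z : ℝ × ℝ × ℝ =>
        2 * (g z.1 z.2.1 z.2.2 - f z.1 z.2.1 z.2.2) * (gt z.1 z.2 - ft z.1 z.2)) (Ioo 0 T ×ˢ Q) :=
      (continuousOn_const.mul hsubc).mul ((hgt.mono hsub).sub (hft.mono hsub))
    refine hasDerivAt_setIntegral_of_continuousOn hQ isOpen_Ioo (s := Ioo 0 T)
      (F := fun t p => (g t p.1 p.2 - f t p.1 p.2) ^ 2)
      (F' := fun t p => 2 * (g t p.1 p.2 - f t p.1 p.2) * (gt t p - ft t p))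
      hsq hprod (fun t ht p _ => ?_) ht
    simpa using! ((hgd t ht p).1.sub (hfd t ht p).1).pow 2
  have hEle : ∀ t ∈ Ioo 0 τ,
      ∫ p in Q, 2 * (g t p.1 p.2 - f t p.1 p.2) * (gt t p - ft t p) ≤ C * E t := fun t ht => by
    have htc : t ∈ Icc 0 τ := Ioo_subset_Icc_self ht
    have htI : t ∈ Ico 0 T := hIco htc
    have htO : t ∈ Ioo 0 T := ⟨ht.1, ht.2.trans hτ⟩
    refine integral_sub_mul_sub_le hρ (k := k) (k' := k') (F := fun p => f t p.1 p.2)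
      (G := fun p => g t p.1 p.2) (Fx := fx t) (Gx := gx t) hk1.continuous hkc' hkd
      (hf.continuous htI) (hg.continuous htI) (hslice hfx t htI) (hslice hgx t htI)
      (hslice hft t htI) (hslice hgt t htI) (hfs t htc) (hgs t htc)
      (fun θ x => (hfd t htO (θ, x)).2.1) (fun θ x => (hgd t htO (θ, x)).2.1)
      (fun θ x => ?_) (fun θ x => ?_) hkL hkL' (hfB t htc) (hgB t htc) (hfxB t htc)
    · simpa only [hvel (hfs t htc)] using (hfd t htO (θ, x)).2.2
    · simpa only [hvel (hgs t htc)] using (hgd t htO (θ, x)).2.2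
  -- The derivative of `E` is available only for `t > 0`, so continuity up to 0 must be shown
  -- separately; projecting time onto `[0, τ]` makes the integrand globally continuous.
  have hEc : ContinuousOn E (Icc 0 τ) := by
    have h1 : Continuous fun t => ∫ p in Q, (g (projIcc 0 τ hτ0 t) p.1 p.2
        - f (projIcc 0 τ hτ0 t) p.1 p.2) ^ 2 := by
      refine continuous_parametric_integral_of_continuous
        (f := fun t (p : ℝ × ℝ) => (g (projIcc 0 τ hτ0 t) p.1 p.2
        - f (projIcc 0 τ hτ0 t) p.1 p.2) ^ 2) ?_ hQ
      have h2 : Continuous fun z : ℝ × (ℝ × ℝ) => ((projIcc 0 τ hτ0 z.1 : ℝ), z.2) := by fun_prop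
      have h3 : ∀ z : ℝ × (ℝ × ℝ), ((projIcc 0 τ hτ0 z.1 : ℝ), z.2) ∈ Ico 0 T ×ˢ (univ : Set (ℝ × ℝ)) :=
        fun z => ⟨hIco (projIcc 0 τ hτ0 z.1).2, mem_univ _⟩
      exact ((hg.continuousOn.comp_continuous h2 h3).sub
        (hf.continuousOn.comp_continuous h2 h3)).pow 2
    refine h1.continuousOn.congr fun t ht => ?_
    simp only [hE, projIcc_of_mem hτ0 ht]
  have hanti : AntitoneOn (fun t => Real.exp (-(C * t)) * E t) (Icc 0 τ) := by
    have hd : ∀ t ∈ Ioo 0 τ, HasDerivAt (fun t => Real.exp (-(C * t)) * E t)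
        (Real.exp (-(C * t)) * (∫ p in Q, 2 * (g t p.1 p.2 - f t p.1 p.2) * (gt t p - ft t p))
          - C * Real.exp (-(C * t)) * E t) t := fun t ht => by
      have h1 : HasDerivAt (fun t => -(C * t)) (-C) t := by
        simpa using! ((hasDerivAt_id t).const_mul C).neg
      refine (h1.exp.mul (hEd t ⟨ht.1, ht.2.trans hτ⟩)).congr_deriv ?_
      ring
    refine antitoneOn_of_deriv_nonpos (convex_Icc 0 τ)
      ((by fun_prop : Continuous fun t : ℝ => Real.exp (-(C * t))).continuousOn.mul hEc) ?_ ?_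
    · rw [interior_Icc]
      exact fun t ht => (hd t ht).differentiableAt.differentiableWithinAt
    · rw [interior_Icc]
      intro t ht
      rw [(hd t ht).deriv]
      have := mul_le_mul_of_nonneg_left (hEle t ht) (Real.exp_pos (-(C * t))).le
      linarith
  have hE0 : E 0 = 0 := by simp [hE, hg.initial, hf.initial]
  have hEτ : E τ ≤ 0 := by
    have := hanti ⟨le_rfl, hτ0⟩ ⟨hτ0, le_rfl⟩ hτ0
    simp only [hE0, mul_zero] at this
    exact nonpos_of_mul_nonpos_right this (Real.exp_pos _)
  have hτI : τ ∈ Icc 0 τ := ⟨hτ0, le_rfl⟩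
  set h : ℝ × ℝ → ℝ := fun p => (g τ p.1 p.2 - f τ p.1 p.2) ^ 2 with hh
  have hhc : Continuous h := ((hg.continuous (hIco hτI)).sub (hf.continuous (hIco hτI))).pow 2
  have hhs : ∀ p, h p ≠ 0 → |p.1| ≤ ρ ∧ |p.2| ≤ ρ := fun p hp => by
    by_cases hfp : f τ p.1 p.2 = 0
    · exact hgs τ hτI p fun h0 => hp (by simp [hh, hfp, h0])
    · exact hfs τ hτI p hfp
  have hint : ∫ p, h p = 0 := by
    rw [← setIntegral_eq_integral_of_forall_compl_eq_zero (s := Q)]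
    · exact le_antisymm hEτ (integral_nonneg fun p => sq_nonneg _)
    · intro p hp
      by_contra h0
      exact hp ⟨abs_le.1 (hhs p h0).1, abs_le.1 (hhs p h0).2⟩
  have hae := (integral_eq_zero_iff_of_nonneg (fun p => sq_nonneg _)
    (integrable_of_continuous_of_bounded_support hhc hhs)).1 hint
  have hzero : h = 0 := hhc.ae_eq_iff_eq volume continuous_zero |>.1 hae
  have := congr_fun hzero (θ, r)
  simpa [hh, sub_eq_zero] using this

end IsClassicalSolution

end Uniqueness

theorem mainTheorem3 (b : ℝ → ℝ) (hb : IsOutcomeFunction b)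
    (w : ℝ → ℝ) (hw : IsInteractionRate w) (σ : ℝ) (hσ : 0 ≤ σ)
    (f₀ : ℝ → ℝ → ℝ) (hf₀ : ContDiff ℝ 1 (fun p : ℝ × ℝ => f₀ p.1 p.2))
    (hsupp : HasCompactSupport (fun p : ℝ × ℝ => f₀ p.1 p.2))
    (T : ℝ) (hT : 0 < T) :
    ∃ f : ℝ → ℝ → ℝ → ℝ, IsClassicalSolution w b σ f₀ T f ∧
      ∀ g : ℝ → ℝ → ℝ → ℝ, IsClassicalSolution w b σ f₀ T g →
        ∀ t ∈ Ico 0 T, ∀ θ r : ℝ, g t θ r = f t θ r := by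
  obtain ⟨f, hf⟩ := exists_isClassicalSolution hb hw σ hf₀ hsupp hT
  obtain ⟨R, -, hR⟩ := exists_abs_le_of_hasCompactSupport hsupp
  exact ⟨f, hf, fun g hg t ht θ r => hf.eq_on_Icc hb hw hg hR ht.1 ht.2 θ r⟩
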